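/- Let $k$ be an algebraically closed field and let $A$ be a finite dimensional basic $k$-algebra with ordinary quiver $Q_A$ (for a complete set $e_1,\dots,e_n$ of primitive orthogonal idempotents of $A$, the vertices of $Q_A$ are $1,\dots,n$ and there are $\dim_k e_i(\operatorname{rad}A/\operatorname{rad}^2A)e_j$ arrows from $i$ to $j$). All modules are finitely generated basic right $A$-modules unless stated otherwise (basic: a direct sum of pairwise non-isomorphic indecomposable modules), $|M|$ denotes the number of isomorphism classes of indecomposable direct summands of $M$, and $\operatorname{add}M$ is the class of all (not necessarily basic) direct summands of finite direct sums of copies of $M$. A module $M$ is $\tau$-tilting if $\operatorname{Hom}_A(M,\tau M)=0$ and $|M|=|A|$, where $\tau$ is the Auslander–Reiten translation; a module $T$ is tilting if $\operatorname{pd}_A T\le 1$, $\operatorname{Ext}^1_A(T,T)=0$ and there is an exact sequence $0\to A\to T_0\to T_1\to 0$ with $T_0,T_1\in\operatorname{add}T$. Theorem. The algebra $A$ is hereditary if and only if $Q_A$ has no loop and every $\tau$-tilting $A$-module is tilting. -/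

import Mathlib

/-!
Right modules over `A` are modules over `Aᵐᵒᵖ`.
-/

universe u v w

noncomputable section

namespace TauTilting

section Modules

variable (R : Type v) [Ring R]

/-- `M` is indecomposable: it is nonzero and is not the direct sum of two nonzero submodules. -/
def IsIndecomposable (M : Type w) [AddCommGroup M] [Module R M] : Prop :=
  Nontrivial M ∧ ∀ U V : Submodule R M, IsCompl U V → U = ⊥ ∨ V = ⊥

/-- `M` is basic: it is a finite direct sum of pairwise non-isomorphic indecomposable modules. -/
def IsBasicModule (M : Type w) [AddCommGroup M] [Module R M] : Prop :=
  ∃ (n : ℕ) (N : Fin n → Submodule R M), DirectSum.IsInternal N ∧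
    (∀ i, IsIndecomposable R (N i)) ∧ ∀ i j, Nonempty (N i ≃ₗ[R] N j) → i = j

/-- The indecomposable direct summands of `M`, as submodules of `M`. -/
def IndecSummand (M : Type w) [AddCommGroup M] [Module R M] : Type w :=
  {N : Submodule R M // IsIndecomposable R N ∧ ∃ N' : Submodule R M, IsCompl N N'}

/-- Isomorphism of indecomposable direct summands. -/
def indecSummandSetoid (M : Type w) [AddCommGroup M] [Module R M] :
    Setoid (IndecSummand R M) where
  r N N' := Nonempty (N.1 ≃ₗ[R] N'.1)
  iseqv :=
    ⟨fun _ => ⟨LinearEquiv.refl _ _⟩, fun ⟨f⟩ => ⟨f.symm⟩, fun ⟨f⟩ ⟨g⟩ => ⟨f.trans g⟩⟩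

/-- `|M|`: the number of isomorphism classes of indecomposable direct summands of `M`. -/
def numSummands (M : Type w) [AddCommGroup M] [Module R M] : ℕ∞ :=
  ENat.card (Quotient (indecSummandSetoid R M))

/-- `X ∈ add T`: `X` is a direct summand of a finite direct sum of copies of `T`. -/
def InAdd (T X : Type w) [AddCommGroup T] [Module R T] [AddCommGroup X] [Module R X] : Prop :=
  ∃ (n : ℕ) (i : X →ₗ[R] (Fin n → T)) (r : (Fin n → T) →ₗ[R] X), r ∘ₗ i = LinearMap.id

/-- A submodule `K` of `P` is superfluous if `N + K = P` forces `N = P`. -/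
def IsSuperfluous {R : Type v} [Ring R] {P : Type w} [AddCommGroup P] [Module R P]
    (K : Submodule R P) : Prop :=
  ∀ N : Submodule R P, N ⊔ K = ⊤ → N = ⊤

/-- A minimal projective presentation `P₁ → P₀ → M → 0` by finitely generated projective modules:
`P₀ → M` and `P₁ → ker (P₀ → M)` are projective covers. -/
structure MinimalPresentation (M : Type w) [AddCommGroup M] [Module R M] where
  P₁ : Type v
  P₀ : Type v
  [addCommGroup₁ : AddCommGroup P₁]
  [addCommGroup₀ : AddCommGroup P₀]
  [module₁ : Module R P₁]
  [module₀ : Module R P₀]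
  [finite₁ : Module.Finite R P₁]
  [finite₀ : Module.Finite R P₀]
  [projective₁ : Module.Projective R P₁]
  [projective₀ : Module.Projective R P₀]
  d : P₁ →ₗ[R] P₀
  p : P₀ →ₗ[R] M
  surjective : Function.Surjective p
  exact : Function.Exact d p
  superfluous₀ : IsSuperfluous (LinearMap.ker p)
  superfluous₁ : IsSuperfluous (LinearMap.ker d)

attribute [instance] MinimalPresentation.addCommGroup₁ MinimalPresentation.addCommGroup₀
  MinimalPresentation.module₁ MinimalPresentation.module₀
  MinimalPresentation.finite₁ MinimalPresentation.finite₀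
  MinimalPresentation.projective₁ MinimalPresentation.projective₀

/-- Finitely generated modules over an artinian ring have projective covers. -/
theorem exists_projectiveCover [IsArtinianRing R] (M : Type w) [AddCommGroup M] [Module R M]
    [Module.Finite R M] :
    ∃ (n : ℕ) (N : Submodule R (Fin n → R)) (p : N →ₗ[R] M), Module.Projective R N ∧
      Module.Finite R N ∧ Function.Surjective p ∧ IsSuperfluous (LinearMap.ker p) := by
  obtain ⟨n, f, hf⟩ := Module.Finite.exists_fin' R M
  obtain ⟨N, hN, hmin⟩ := (wellFounded_lt (α := Submodule R (Fin n → R))).has_min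
    {N | N.map f = ⊤} ⟨⊤, by simpa using LinearMap.range_eq_top.2 hf⟩
  have hN' : N.map f = ⊤ := hN
  have hsurj : Function.Surjective (f.domRestrict N) := by
    rw [← LinearMap.range_eq_top, LinearMap.range_domRestrict, hN']
  obtain ⟨g, hg⟩ := Module.projective_lifting_property (f.domRestrict N) f hsurj
  have hgx : ∀ x, f (g x : Fin n → R) = f x := fun x => LinearMap.congr_fun hg x
  have hs : Function.Surjective (g ∘ₗ N.subtype) := by
    have h1 : ((LinearMap.range (g ∘ₗ N.subtype)).map N.subtype).map f = ⊤ := by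
      rw [eq_top_iff]
      rintro m -
      obtain ⟨x, rfl⟩ := hsurj m
      exact ⟨g x, ⟨g x, ⟨x, rfl⟩, rfl⟩, hgx x⟩
    have h2 : (LinearMap.range (g ∘ₗ N.subtype)).map N.subtype = N := by
      by_contra hne
      exact hmin _ h1 (lt_of_le_of_ne (Submodule.map_subtype_le _ _) hne)
    intro y
    have hy : (y : Fin n → R) ∈ (LinearMap.range (g ∘ₗ N.subtype)).map N.subtype := by
      rw [h2]; exact y.2
    obtain ⟨z, ⟨x, hx⟩, hz⟩ := hy
    exact ⟨x, hx.trans (Subtype.ext hz)⟩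
  have hb : Function.Bijective (g ∘ₗ N.subtype) := 
    ⟨IsNoetherian.injective_of_surjective_endomorphism _ hs, hs⟩
  let e := LinearEquiv.ofBijective _ hb
  have hproj : Module.Projective R N := by
    refine Module.Projective.of_split (N.subtype ∘ₗ e.symm.toLinearMap) g ?_
    ext1 x
    exact e.apply_symm_apply x
  refine ⟨n, N, f.domRestrict N, hproj, inferInstance, hsurj, fun L hL => ?_⟩
  have h1 : (L.map N.subtype).map f = ⊤ := by
    have h : L.map (f.domRestrict N) = ⊤ := by
      have := congrArg (Submodule.map (f.domRestrict N)) hL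
      rwa [Submodule.map_sup, (LinearMap.le_ker_iff_map).1 le_rfl, sup_bot_eq, Submodule.map_top,
        LinearMap.range_eq_top.2 hsurj] at this
    rw [← h, ← Submodule.map_comp]; rfl
  have h2 : L.map N.subtype = N := by
    by_contra hne
    exact hmin _ h1 (lt_of_le_of_ne (Submodule.map_subtype_le _ _) hne)
  rw [eq_top_iff]
  rintro y -
  have hy : (y : Fin n → R) ∈ L.map N.subtype := by rw [h2]; exact y.2
  obtain ⟨z, hz, hzy⟩ := hy
  rwa [← Subtype.ext (a1 := z) (a2 := y) hzy]

/-- Finitely generated modules over an artinian ring have minimal projective presentations. -/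
theorem exists_minimalPresentation [IsArtinianRing R] (M : Type w) [AddCommGroup M] [Module R M]
    [Module.Finite R M] : Nonempty (MinimalPresentation R M) := by
  obtain ⟨n, N, p, _, _, hp, hs⟩ := exists_projectiveCover R M
  obtain ⟨m, L, q, _, _, hq, hs'⟩ := exists_projectiveCover R (LinearMap.ker p)
  exact ⟨{
    P₁ := L
    P₀ := N
    d := (LinearMap.ker p).subtype ∘ₗ q
    p := p
    surjective := hp
    exact := by
      rw [LinearMap.exact_iff, LinearMap.range_comp, LinearMap.range_eq_top.2 hq]
      simp
    superfluous₀ := hs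
    superfluous₁ := by
      rw [LinearMap.ker_comp, Submodule.ker_subtype, Submodule.comap_bot]
      exact hs' }⟩

end Modules

section Duality

variable (k : Type u) {A : Type v} [Field k] [Ring A] [Algebra k A]

/-- The dual `D N = Hom_k(N, k)` of a left `A`-module `N`. It is a right `A`-module. -/
def KDual (_k : Type u) (N : Type w) [Field _k] [AddCommGroup N] [Module _k N] :
    Type (max w u) := N →ₗ[_k] _k

instance (N : Type w) [AddCommGroup N] [Module k N] : AddCommGroup (KDual k N) :=
  inferInstanceAs (AddCommGroup (N →ₗ[k] k))

/-- The right action on `D N` is `(φ · a)(x) = φ(a x)`. -/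
instance (N : Type w) [AddCommGroup N] [Module k N] [Module A N] [IsScalarTower k A N] :
    Module Aᵐᵒᵖ (KDual k N) where
  smul a φ := (show N →ₗ[k] k from φ) ∘ₗ DistribSMul.toLinearMap k N a.unop
  one_smul φ := LinearMap.ext fun x => congrArg (show N →ₗ[k] k from φ) (one_smul A x)
  mul_smul a b φ := LinearMap.ext fun x =>
    congrArg (show N →ₗ[k] k from φ) (mul_smul b.unop a.unop x)
  smul_zero _ := LinearMap.ext fun _ => rfl
  smul_add _ _ _ := LinearMap.ext fun _ => rfl
  add_smul a b φ := LinearMap.ext fun x =>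
    (congrArg (show N →ₗ[k] k from φ) (add_smul a.unop b.unop x)).trans (map_add _ _ _)
  zero_smul φ := LinearMap.ext fun x =>
    (congrArg (show N →ₗ[k] k from φ) (zero_smul A x)).trans (map_zero _)

/-- `Hom_A(d, A) : Hom_A(Q, A) → Hom_A(P, A)` for a homomorphism `d : P → Q` of right modules,
as a homomorphism of left `A`-modules. -/
def homToRing {P Q : Type v} [AddCommGroup P] [Module Aᵐᵒᵖ P] [AddCommGroup Q] [Module Aᵐᵒᵖ Q]
    (d : P →ₗ[Aᵐᵒᵖ] Q) : (Q →ₗ[Aᵐᵒᵖ] A) →ₗ[A] (P →ₗ[Aᵐᵒᵖ] A) where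
  toFun f := f ∘ₗ d
  map_add' _ _ := rfl
  map_smul' _ _ := rfl

/-- The transpose `Tr M = coker (Hom_A(P₀, A) → Hom_A(P₁, A))`, a left `A`-module, computed from a
minimal projective presentation of the right module `M`. -/
abbrev MinimalPresentation.Tr {M : Type w} [AddCommGroup M] [Module Aᵐᵒᵖ M]
    (π : MinimalPresentation Aᵐᵒᵖ M) : Type v :=
  (π.P₁ →ₗ[Aᵐᵒᵖ] A) ⧸ LinearMap.range (homToRing π.d)

variable (A) [FiniteDimensional k A]

/-- A minimal projective presentation of a finitely generated right `A`-module. -/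
def minimalPresentation (M : Type w) [AddCommGroup M] [Module Aᵐᵒᵖ M] [Module.Finite Aᵐᵒᵖ M] :
    MinimalPresentation Aᵐᵒᵖ M :=
  haveI : IsArtinianRing Aᵐᵒᵖ := isArtinian_of_tower k inferInstance
  (exists_minimalPresentation Aᵐᵒᵖ M).some

/-- The Auslander-Reiten translate `τ M = D Tr M` of a finitely generated right `A`-module. -/
abbrev ARTranslate (M : Type w) [AddCommGroup M] [Module Aᵐᵒᵖ M] [Module.Finite Aᵐᵒᵖ M] :
    Type (max u v) :=
  KDual k (minimalPresentation k A M).Tr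

/-- `M` is `τ`-rigid: `Hom_A(M, τ M) = 0`. -/
def IsTauRigid (M : Type w) [AddCommGroup M] [Module Aᵐᵒᵖ M] [Module.Finite Aᵐᵒᵖ M] : Prop :=
  ∀ f : M →ₗ[Aᵐᵒᵖ] ARTranslate k A M, f = 0

/-- `M` is `τ`-tilting: it is `τ`-rigid and `|M| = |A|`. -/
def IsTauTilting (M : Type w) [AddCommGroup M] [Module Aᵐᵒᵖ M] [Module.Finite Aᵐᵒᵖ M] : Prop :=
  IsTauRigid k A M ∧ numSummands Aᵐᵒᵖ M = numSummands Aᵐᵒᵖ A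

end Duality

section Algebras

variable (A : Type v) [Ring A]

/-- `T` is a tilting right `A`-module: `pd T ≤ 1`, `Ext¹(T, T) = 0` and there is an exact sequence
`0 → A → T₀ → T₁ → 0` with `T₀, T₁ ∈ add T`. -/
def IsTilting (T : Type v) [AddCommGroup T] [Module Aᵐᵒᵖ T] : Prop :=
  CategoryTheory.HasProjectiveDimensionLE (ModuleCat.of Aᵐᵒᵖ T) 1 ∧
  Subsingleton (CategoryTheory.Abelian.Ext (ModuleCat.of Aᵐᵒᵖ T) (ModuleCat.of Aᵐᵒᵖ T) 1) ∧
  ∃ (T₀ T₁ : ModuleCat.{v} Aᵐᵒᵖ) (f : A →ₗ[Aᵐᵒᵖ] T₀) (g : T₀ →ₗ[Aᵐᵒᵖ] T₁),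
    InAdd Aᵐᵒᵖ T T₀ ∧ InAdd Aᵐᵒᵖ T T₁ ∧
    Function.Injective f ∧ Function.Exact f g ∧ Function.Surjective g

/-- `A` is hereditary: all right ideals and all left ideals are projective. -/
def IsHereditary : Prop :=
  (∀ I : Submodule Aᵐᵒᵖ A, Module.Projective Aᵐᵒᵖ I) ∧ ∀ I : Submodule A A, Module.Projective A I

variable {A} in
/-- A primitive idempotent: a nonzero idempotent that is not the sum of two nonzero orthogonal
idempotents. -/
def IsPrimitiveIdempotent (e : A) : Prop :=
  IsIdempotentElem e ∧ e ≠ 0 ∧ ∀ f g : A, IsIdempotentElem f → IsIdempotentElem g →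
    f * g = 0 → g * f = 0 → e = f + g → f = 0 ∨ g = 0

/-- `e` is a complete set of primitive orthogonal idempotents with `eᵢ A ≇ eⱼ A` for `i ≠ j`. -/
def IsBasicSystem {n : ℕ} (e : Fin n → A) : Prop :=
  CompleteOrthogonalIdempotents e ∧ (∀ i, IsPrimitiveIdempotent (e i)) ∧
    ∀ i j, Nonempty (Submodule.span Aᵐᵒᵖ {e i} ≃ₗ[Aᵐᵒᵖ] Submodule.span Aᵐᵒᵖ {e j}) → i = j

/-- `A` is a basic algebra. -/
def IsBasicAlgebra : Prop := ∃ (n : ℕ) (e : Fin n → A), IsBasicSystem A e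

variable (k : Type u) [Field k] [Algebra k A]

/-- The `k`-space `a (rad A / rad² A) b`, as a subspace of `A / rad² A`. -/
def arrowSpace {A : Type v} [Ring A] [Algebra k A] (a b : A) :
    Submodule k (A ⧸ (Ring.jacobson A * Ring.jacobson A).restrictScalars k) :=
  ((Ring.jacobson A).restrictScalars k).map
    (((Ring.jacobson A * Ring.jacobson A).restrictScalars k).mkQ ∘ₗ
      LinearMap.mulLeft k a ∘ₗ LinearMap.mulRight k b)

variable {A} in
/-- The vertices of the ordinary quiver `Q_A` of a basic algebra: they number the elements of a
complete set `e` of primitive orthogonal idempotents. -/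
def OrdinaryQuiver (_k : Type u) [Field _k] [Algebra _k A] (hA : IsBasicAlgebra A) : Type :=
  Fin hA.choose

variable {A} {k} in
/-- The idempotent `eₓ` at the vertex `x`. -/
def OrdinaryQuiver.idem {hA : IsBasicAlgebra A} (x : OrdinaryQuiver k hA) : A :=
  hA.choose_spec.choose x

/-- There are `dim_k eₓ (rad A / rad² A) e_y` arrows from `x` to `y` in `Q_A`. -/
instance (hA : IsBasicAlgebra A) : Quiver (OrdinaryQuiver k hA) where
  Hom x y := Fin (Module.finrank k (arrowSpace k x.idem y.idem))

end Algebras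

end TauTilting

end

/-! Everything is read off a minimal projective presentation d : P₁ → P₀ of a module M. The space
Hom(M, τM) is dual to the cokernel of Hom(P₀, M) → Hom(P₁, M), so M is τ-rigid exactly when every
map P₁ → M factors through d (`isTauRigid_iff_isRigid`).

Counting summands rests on the functions Z ↦ dim Hom(X, Z), with Z running over the modules
generated by M. For pairwise non-isomorphic indecomposable summands X of M they are linearly
independent (`linearIndependent_homFun`). If M is τ-rigid, then dim Hom(X, Z) = dim Hom(P₀, Z) − dim
Hom(P₁, Z) for a minimal presentation of X, so they lie in the span of the n functions given by the
indecomposable projectives. Hence |M| ≤ n = |A| (`IsProjectiveSystem.numSummands_le`).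

A Bongartz construction reaches the bound. For τ-rigid U and projective Q, let E be the cokernel of
(d, φ) : P₁ᵐ → P₀ᵐ × Q, where φ collects a basis of Hom(P₁, Q). Adding such modules E to U preserves
rigidity, and letting Q run over all indecomposable projectives yields n summands
(`IsProjectiveSystem.exists_completion`).

If A is hereditary, d is injective, whence pd M ≤ 1 and Ext¹(M, M) = 0 for τ-tilting M. With Q = A
one gets 0 → A → E → Mᵐ → 0, and since M ⊕ E is τ-rigid while |M| = n is already maximal, E lies in
add M. Loops are excluded because a nonzero endomorphism of an indecomposable projective is
injective, whereas one coming from the radical is nilpotent.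

Conversely, if there are no loops, a simple module S does not occur in the top of the radical of its
projective cover. Thus Hom(P₁, S) = 0, S is τ-rigid, and it is a summand of a basic τ-tilting
module, so pd S ≤ 1. Induction on length gives pd (A/I) ≤ 1, so every right ideal I is projective;
left ideals follow by k-duality (`projective_of_forall_projective_op`). -/

namespace TauTilting

/-! ### Retracts, Fitting's lemma and local endomorphism rings. -/

section KrullSchmidt

/-- `X` is isomorphic to a direct summand of `Y`. -/
def IsRetract (R : Type*) [Ring R] (X Y : Type*) [AddCommGroup X] [Module R X]
    [AddCommGroup Y] [Module R Y] : Prop :=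
  ∃ (i : X →ₗ[R] Y) (r : Y →ₗ[R] X), r ∘ₗ i = LinearMap.id

variable {R : Type*} [Ring R] {X Y Z T : Type*} [AddCommGroup X] [Module R X]
  [AddCommGroup Y] [Module R Y] [AddCommGroup Z] [Module R Z] [AddCommGroup T] [Module R T]

theorem IsRetract.refl : IsRetract R X X := ⟨LinearMap.id, LinearMap.id, rfl⟩

theorem IsRetract.of_equiv (e : X ≃ₗ[R] Y) : IsRetract R X Y :=
  ⟨e, e.symm, by ext; simp⟩

theorem IsRetract.trans : IsRetract R X Y → IsRetract R Y Z → IsRetract R X Z := by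
  rintro ⟨i, r, h⟩ ⟨j, s, h'⟩
  refine ⟨j ∘ₗ i, r ∘ₗ s, ?_⟩
  ext x
  have h1 := LinearMap.congr_fun h x
  have h2 := LinearMap.congr_fun h' (i x)
  simp only [LinearMap.comp_apply, LinearMap.id_apply] at *
  rw [h2, h1]

theorem IsRetract.pi {ι : Type*} {X Y : ι → Type*} [∀ i, AddCommGroup (X i)]
    [∀ i, Module R (X i)] [∀ i, AddCommGroup (Y i)] [∀ i, Module R (Y i)]
    (h : ∀ i, IsRetract R (X i) (Y i)) : IsRetract R (Π i, X i) (Π i, Y i) := by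
  choose i r h using h
  refine ⟨LinearMap.piMap i, LinearMap.piMap r, ?_⟩
  ext x j
  exact LinearMap.congr_fun (h j) (x j)

theorem IsRetract.pi_apply {ι : Type*} (Y : ι → Type*) [∀ i, AddCommGroup (Y i)]
    [∀ i, Module R (Y i)] (i : ι) : IsRetract R (Y i) (Π i, Y i) := by
  classical
  exact ⟨LinearMap.single R Y i, LinearMap.proj i, by ext; simp⟩

theorem IsRetract.prod_left : IsRetract R X (X × Y) :=
  ⟨LinearMap.inl R X Y, LinearMap.fst R X Y, LinearMap.fst_comp_inl R X Y⟩

theorem IsRetract.prod_right : IsRetract R Y (X × Y) :=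
  ⟨LinearMap.inr R X Y, LinearMap.snd R X Y, LinearMap.snd_comp_inr R X Y⟩

theorem IsRetract.of_isCompl {U V : Submodule R X} (h : IsCompl U V) : IsRetract R U X :=
  ⟨U.subtype, U.projectionOnto V h, by ext x; simp⟩

theorem IsRetract.finite (h : IsRetract R X Y) [Module.Finite R Y] : Module.Finite R X := by
  obtain ⟨i, r, h⟩ := h
  exact Module.Finite.of_surjective r fun x => ⟨i x, LinearMap.congr_fun h x⟩

theorem IsRetract.projective (h : IsRetract R X Y) [Module.Projective R Y] :
    Module.Projective R X := by
  obtain ⟨i, r, h⟩ := h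
  exact Module.Projective.of_split i r h

/-- A split monomorphism gives an isomorphism onto a direct summand. -/
theorem exists_isCompl_of_split {i : X →ₗ[R] Y} {r : Y →ₗ[R] X} (h : r ∘ₗ i = LinearMap.id) :
    Nonempty (X ≃ₗ[R] LinearMap.range i) ∧ IsCompl (LinearMap.range i) (LinearMap.ker r) := by
  have hi : Function.Injective i := fun a b hab => by
    simpa using (LinearMap.congr_fun h a).symm.trans
      ((congrArg r hab).trans (LinearMap.congr_fun h b))
  refine ⟨⟨LinearEquiv.ofInjective i hi⟩, ?_⟩
  exact LinearMap.isCompl_of_proj (f := (LinearEquiv.ofInjective i hi).toLinearMap ∘ₗ r)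
    (fun ⟨_, x, hx⟩ => by
      subst hx
      exact Subtype.ext (congrArg i (LinearMap.congr_fun h x))) |> fun h' => by
    simpa [LinearMap.ker_comp] using h'

theorem IsIndecomposable.of_equiv (e : X ≃ₗ[R] Y) (h : IsIndecomposable R X) :
    IsIndecomposable R Y := by
  obtain ⟨h1, h2⟩ := h
  refine ⟨e.symm.toEquiv.nontrivial, fun U V hUV => ?_⟩
  have := h2 (U.comap e.toLinearMap) (V.comap e.toLinearMap)
    (hUV.map (Submodule.orderIsoMapComap e).symm)
  refine this.imp (fun h => ?_) fun h => ?_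
  · exact (Submodule.orderIsoMapComap e).symm.injective (by simpa using h)
  · exact (Submodule.orderIsoMapComap e).symm.injective (by simpa using h)

theorem isUnit_right_of_isUnit_mul [IsArtinian R T] {f g : Module.End R T}
    (hu : IsUnit (f * g)) : IsUnit g := by
  rw [Module.End.isUnit_iff] at *
  have : Function.Injective g := by
    have h2 := hu.1
    exact Function.Injective.of_comp h2
  exact ⟨this, IsArtinian.surjective_of_injective_endomorphism g this⟩

/-- If a composition `T → X → T` is bijective, then `T` is a direct summand of `X`. -/
theorem IsRetract.of_isUnit {i : T →ₗ[R] X} {r : X →ₗ[R] T}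
    (hu : IsUnit (r ∘ₗ i : Module.End R T)) : IsRetract R T X := by
  obtain ⟨g, hg⟩ := hu.exists_left_inv
  exact ⟨i, (g : T →ₗ[R] T) ∘ₗ r, hg⟩

theorem IsIndecomposable.equiv_of_isRetract (hX : IsIndecomposable R X) (hT : Nontrivial Y)
    (h : IsRetract R Y X) : Nonempty (Y ≃ₗ[R] X) := by
  obtain ⟨i, r, h⟩ := h
  obtain ⟨⟨e⟩, hc⟩ := exists_isCompl_of_split h
  rcases hX.2 _ _ hc with h0 | h0
  · exfalso
    rw [LinearMap.range_eq_bot] at h0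
    subst h0
    obtain ⟨y, hy⟩ := exists_ne (0 : Y)
    exact hy (by simpa using (LinearMap.congr_fun h y).symm)
  · refine ⟨LinearEquiv.ofBijective i ⟨?_, ?_⟩⟩
    · exact fun a b hab => by
        simpa using (LinearMap.congr_fun h a).symm.trans
          ((congrArg r hab).trans (LinearMap.congr_fun h b))
    · rw [← LinearMap.range_eq_top]
      simpa [h0] using hc.sup_eq_top

variable [IsNoetherian R T] [IsArtinian R T]

/-- Fitting's lemma: the kernel and the range of a high power of `f` are complementary. -/
theorem IsIndecomposable.isUnit_or_isNilpotent (h : IsIndecomposable R T) (f : Module.End R T) :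
    IsUnit f ∨ IsNilpotent f := by
  obtain ⟨n, hn⟩ := Filter.eventually_atTop.1 f.eventually_isCompl_ker_pow_range_pow
  -- The exponent must be positive for injectivity of the power to descend to `f`.
  have hn' := hn (n + 1) (by omega)
  rcases h.2 _ _ hn' with h0 | h0
  · left
    rw [Module.End.isUnit_iff]
    have : Function.Injective f := by
      have := LinearMap.ker_eq_bot.1 h0
      rw [pow_succ] at this
      exact Function.Injective.of_comp this
    exact ⟨this, IsArtinian.surjective_of_injective_endomorphism f this⟩
  · right
    exact ⟨n + 1, LinearMap.range_eq_bot.1 h0⟩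

theorem IsIndecomposable.isLocalRing (h : IsIndecomposable R T) :
    IsLocalRing (Module.End R T) := by
  have := h.1
  refine ⟨fun {a b} hab => ?_⟩
  refine (h.isUnit_or_isNilpotent a).imp_right fun ha => ?_
  rw [← eq_sub_iff_add_eq'] at hab
  rw [hab]
  exact ha.isUnit_one_sub

/-- The identity of `T` is the sum of the endomorphisms that pass through the factors `Y j`. As `End
T` is local, one of them is a unit. -/
theorem IsIndecomposable.exists_isRetract (h : IsIndecomposable R T) {ι : Type*} [Finite ι]
    {Y : ι → Type*} [∀ i, AddCommGroup (Y i)] [∀ i, Module R (Y i)]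
    (hr : IsRetract R T (Π i, Y i)) : ∃ i, IsRetract R T (Y i) := by
  classical
  cases nonempty_fintype ι
  obtain ⟨i, r, hir⟩ := hr
  have := h.isLocalRing
  have hs : ∑ j, ((r ∘ₗ LinearMap.single R Y j) ∘ₗ (LinearMap.proj j ∘ₗ i) : Module.End R T)
      = 1 := by
    ext x
    have := LinearMap.congr_fun hir x
    simp only [LinearMap.comp_apply, LinearMap.id_apply] at this
    conv_rhs => rw [Module.End.one_apply, ← this]
    rw [LinearMap.sum_apply]
    simp only [LinearMap.comp_apply, LinearMap.proj_apply, LinearMap.coe_single]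
    rw [← map_sum, Finset.univ_sum_single]
  obtain ⟨j, -, hj⟩ := IsLocalRing.exists_of_isUnit_sum (hs ▸ isUnit_one)
  exact ⟨j, IsRetract.of_isUnit hj⟩

end KrullSchmidt

/-! ### Induction over direct sum decompositions. -/

section Induction

variable {R : Type v} [Ring R]

theorem subsingleton_or_isIndecomposable_or_split (X : Type w) [AddCommGroup X] [Module R X] :
    Subsingleton X ∨ IsIndecomposable R X ∨
      ∃ U V : Submodule R X, IsCompl U V ∧ U < ⊤ ∧ V < ⊤ := by
  by_cases h : Subsingleton X
  · exact .inl h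
  · rw [not_subsingleton_iff_nontrivial] at h
    refine .inr (or_iff_not_imp_left.2 fun hX => ?_)
    simp only [IsIndecomposable, h, true_and, not_forall, not_or] at hX
    obtain ⟨U, V, hc, hU, hV⟩ := hX
    refine ⟨U, V, hc, lt_top_iff_ne_top.2 ?_, lt_top_iff_ne_top.2 ?_⟩
    · rintro rfl
      exact hV (by simpa using hc.inf_eq_bot)
    · rintro rfl
      exact hU (by simpa using hc.inf_eq_bot)

/-- A property of direct summands of a finitely generated module `X` holds for `X` if it holds for
zero modules, for indecomposable modules and for direct sums. -/
theorem induction_on_isIndecomposable [IsArtinianRing R] {X : Type w} [AddCommGroup X] [Module R X]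
    [Module.Finite R X] (C : Submodule R X → Prop) (h0 : C ⊥)
    (h1 : ∀ U : Submodule R X, IsRetract R U X → IsIndecomposable R U → C U)
    (h2 : ∀ U V : Submodule R X, Disjoint U V → C U → C V → C (U ⊔ V)) : C ⊤ := by
  -- The induction runs over submodules of `X`, where strict inclusion is well founded because `X`
  -- is artinian.
  suffices H : ∀ W : Submodule R X, IsRetract R W X → C W from
    H ⊤ (.of_equiv Submodule.topEquiv)
  intro W
  induction W using WellFoundedLT.induction with
  | ind W ih =>
    intro hW
    rcases subsingleton_or_isIndecomposable_or_split (R := R) W with h | h | ⟨U, V, hc, hU, hV⟩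
    · rw [Submodule.subsingleton_iff_eq_bot] at h
      rwa [h]
    · exact h1 W hW h
    · have key : ∀ U : Submodule R W, U < ⊤ → U.map W.subtype < W := fun U hU => by
        have := (Submodule.map_strictMono_of_injective W.injective_subtype) hU
        simpa using this
      have hr : ∀ {U V : Submodule R W}, IsCompl U V → IsRetract R (U.map W.subtype) X :=
        fun {U V} hc => ((IsRetract.of_equiv (U.equivMapOfInjective W.subtype
          W.injective_subtype).symm).trans (.of_isCompl hc)).trans hW
      have := h2 (U.map W.subtype) (V.map W.subtype)
        (Submodule.disjoint_map W.injective_subtype hc.disjoint)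
        (ih _ (key U hU) (hr hc)) (ih _ (key V hV) (hr hc.symm))
      rwa [← Submodule.map_sup, hc.sup_eq_top, Submodule.map_top, Submodule.range_subtype] at this

end Induction

/-! ### Projective presentations and extension of maps along them. -/

section Presentations

variable {R : Type*} [Ring R] {X Y Z P Q₁ Q₀ : Type*} [AddCommGroup X] [Module R X]
  [AddCommGroup Y] [Module R Y] [AddCommGroup Z] [Module R Z] [AddCommGroup P] [Module R P]
  [AddCommGroup Q₁] [Module R Q₁] [AddCommGroup Q₀] [Module R Q₀]

/-- Every homomorphism from the source of `d` to `Z` factors through `d`. -/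
def IsExtensible (d : Q₁ →ₗ[R] Q₀) (Z : Type*) [AddCommGroup Z] [Module R Z] : Prop :=
  ∀ a : Q₁ →ₗ[R] Z, ∃ b : Q₀ →ₗ[R] Z, b ∘ₗ d = a

/-- `Z` is a quotient of a finite direct sum of copies of `M`. -/
def IsGenerated (R : Type*) [Ring R] (M Z : Type*) [AddCommGroup M] [Module R M] [AddCommGroup Z]
    [Module R Z] : Prop :=
  ∃ (q : ℕ) (f : (Fin q → M) →ₗ[R] Z), Function.Surjective f

theorem exists_lift_of_exact [Module.Projective R P] {d : Q₁ →ₗ[R] Q₀} {p : Q₀ →ₗ[R] X}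
    (h : Function.Exact d p) (f : P →ₗ[R] Q₀) (hf : p ∘ₗ f = 0) :
    ∃ g : P →ₗ[R] Q₁, d ∘ₗ g = f := by
  obtain ⟨g, hg⟩ := Module.projective_lifting_property d.rangeRestrict
    (f.codRestrict (LinearMap.range d) fun x => (h (f x)).1 (LinearMap.congr_fun hf x))
    d.surjective_rangeRestrict
  refine ⟨g, ?_⟩
  ext x
  exact congrArg Subtype.val (LinearMap.congr_fun hg x)

/-- An endomorphism which is surjective modulo a superfluous submodule is bijective. -/
theorem IsSuperfluous.isUnit {P : Type w} [AddCommGroup P] {R : Type v} [Ring R] [Module R P]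
    [IsNoetherian R P]
    {K : Submodule R P} (hK : IsSuperfluous K) (f : Module.End R P)
    (h : LinearMap.range f ⊔ K = ⊤) : IsUnit f := by
  have := LinearMap.range_eq_top.1 (hK _ h)
  rw [Module.End.isUnit_iff]
  exact ⟨IsNoetherian.injective_of_surjective_endomorphism f this, this⟩

/-- If a presentation of a module is extensible to `Z`, then so are the minimal presentations of
its direct summands. -/
theorem IsExtensible.of_isRetract {R : Type v} [Ring R] [IsNoetherianRing R]
    {P₁ P₀ : Type w} {X X' Q₁ Q₀ Z : Type*}
    [AddCommGroup P₁] [Module R P₁] [AddCommGroup P₀] [Module R P₀] [AddCommGroup X] [Module R X]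
    [AddCommGroup X'] [Module R X'] [AddCommGroup Q₁] [Module R Q₁] [AddCommGroup Q₀] [Module R Q₀]
    [AddCommGroup Z] [Module R Z]
    [Module.Finite R P₁] [Module.Finite R P₀] [Module.Projective R P₁] [Module.Projective R P₀]
    {d : P₁ →ₗ[R] P₀} {p : P₀ →ₗ[R] X} (hdp : Function.Exact d p)
    (hp : Function.Surjective p)
    (h0 : IsSuperfluous (LinearMap.ker p)) (h1 : IsSuperfluous (LinearMap.ker d))
    [Module.Projective R Q₁] [Module.Projective R Q₀]
    {d' : Q₁ →ₗ[R] Q₀} {p' : Q₀ →ₗ[R] X'} (hp' : Function.Surjective p')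
    (hdp' : Function.Exact d' p') (hr : IsRetract R X X') (hZ : IsExtensible d' Z) :
    IsExtensible d Z := by
  obtain ⟨i, r, hir⟩ := hr
  obtain ⟨f0, hf0⟩ := Module.projective_lifting_property p' (i ∘ₗ p) hp'
  obtain ⟨g0, hg0⟩ := Module.projective_lifting_property p (r ∘ₗ p') hp
  obtain ⟨f1, hf1⟩ := exists_lift_of_exact hdp' (f0 ∘ₗ d) (by
    rw [← LinearMap.comp_assoc, hf0, LinearMap.comp_assoc, hdp.linearMap_comp_eq_zero,
      LinearMap.comp_zero])
  obtain ⟨g1, hg1⟩ := exists_lift_of_exact hdp (g0 ∘ₗ d') (by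
    rw [← LinearMap.comp_assoc, hg0, LinearMap.comp_assoc, hdp'.linearMap_comp_eq_zero,
      LinearMap.comp_zero])
  -- The lifts of `i` and `r` compose to the identity only modulo `ker p`; superfluity upgrades this
  -- to bijectivity.
  have e0 : ∀ x, p (g0 (f0 x)) = p x := fun x => by
    have a1 := LinearMap.congr_fun hg0 (f0 x)
    have a2 := LinearMap.congr_fun hf0 x
    have a3 := LinearMap.congr_fun hir (p x)
    simp only [LinearMap.comp_apply, LinearMap.id_apply] at a1 a2 a3
    rw [a1, a2, a3]
  have u0 : IsUnit (g0 ∘ₗ f0 : Module.End R P₀) := by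
    refine h0.isUnit _ (eq_top_iff.2 fun x _ => ?_)
    refine Submodule.mem_sup.2 ⟨g0 (f0 x), ⟨x, rfl⟩, x - g0 (f0 x), ?_, by abel⟩
    rw [LinearMap.mem_ker, map_sub, e0, sub_self]
  have e1 : ∀ x, d (g1 (f1 x)) = g0 (f0 (d x)) := fun x => by
    have a1 := LinearMap.congr_fun hg1 (f1 x)
    have a2 := LinearMap.congr_fun hf1 x
    simp only [LinearMap.comp_apply] at a1 a2
    rw [a1, a2]
  have u1 : IsUnit (g1 ∘ₗ f1 : Module.End R P₁) := by
    refine h1.isUnit _ (eq_top_iff.2 fun x _ => ?_)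
    obtain ⟨y, hy⟩ := ((Module.End.isUnit_iff _).1 u0).2 (d x)
    change g0 (f0 y) = d x at hy
    have hpy : p y = 0 := by rw [← e0, hy]; exact hdp.apply_apply_eq_zero x
    obtain ⟨z, rfl⟩ := (hdp y).1 hpy
    refine Submodule.mem_sup.2 ⟨g1 (f1 z), ⟨z, rfl⟩, x - g1 (f1 z), ?_, by abel⟩
    rw [LinearMap.mem_ker, map_sub, e1, hy, sub_self]
  -- Twisting by the inverse of `g1 ∘ f1` makes `P₁` a retract of `Q₁` compatibly with `d` and `d'`,
  -- so an extension problem along `d` becomes one along `d'`.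
  obtain ⟨s, hs⟩ := u1.exists_left_inv
  intro a
  obtain ⟨b, hb⟩ := hZ (a ∘ₗ (s : P₁ →ₗ[R] P₁) ∘ₗ g1)
  refine ⟨b ∘ₗ f0, ?_⟩
  ext x
  have a1 := LinearMap.congr_fun hb (f1 x)
  have a2 := LinearMap.congr_fun hf1 x
  have a3 : s (g1 (f1 x)) = x := LinearMap.congr_fun hs x
  simp only [LinearMap.comp_apply] at a1 a2 ⊢
  rw [← a2, a1, a3]

theorem IsExtensible.of_isRetract_right {d : Q₁ →ₗ[R] Q₀} (h : IsExtensible d Y)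
    (hr : IsRetract R Z Y) : IsExtensible d Z := by
  obtain ⟨i, r, hir⟩ := hr
  intro a
  obtain ⟨b, hb⟩ := h (i ∘ₗ a)
  exact ⟨r ∘ₗ b, by rw [LinearMap.comp_assoc, hb, ← LinearMap.comp_assoc, hir, LinearMap.id_comp]⟩

theorem IsExtensible.pi_right {d : Q₁ →ₗ[R] Q₀} {ι : Type*} {Y : ι → Type*}
    [∀ i, AddCommGroup (Y i)] [∀ i, Module R (Y i)] (h : ∀ i, IsExtensible d (Y i)) :
    IsExtensible d (Π i, Y i) := by
  intro a
  choose b hb using fun i => h i (LinearMap.proj i ∘ₗ a)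
  refine ⟨LinearMap.pi b, ?_⟩
  ext x i
  exact LinearMap.congr_fun (hb i) x

theorem IsExtensible.prod_right {d : Q₁ →ₗ[R] Q₀} (h : IsExtensible d Y) (h' : IsExtensible d Z) :
    IsExtensible d (Y × Z) := by
  intro a
  obtain ⟨b, hb⟩ := h (LinearMap.fst R Y Z ∘ₗ a)
  obtain ⟨c, hc⟩ := h' (LinearMap.snd R Y Z ∘ₗ a)
  refine ⟨b.prod c, ?_⟩
  ext x
  exacts [LinearMap.congr_fun hb x, LinearMap.congr_fun hc x]

/-- A map from the projective module `Q₁` to a quotient of `Y^q` lifts to `Y^q`, where it can be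
extended. For this reason the dimension counts are made on modules generated by `M` only. -/
theorem IsExtensible.of_isGenerated [Module.Projective R Q₁] {d : Q₁ →ₗ[R] Q₀}
    (h : IsExtensible d Y) (hZ : IsGenerated R Y Z) : IsExtensible d Z := by
  obtain ⟨q, f, hf⟩ := hZ
  intro a
  obtain ⟨a', ha'⟩ := Module.projective_lifting_property f a hf
  obtain ⟨b, hb⟩ := IsExtensible.pi_right (fun _ : Fin q => h) a'
  exact ⟨f ∘ₗ b, by rw [LinearMap.comp_assoc, hb, ha']⟩

theorem IsExtensible.pi_left {ι : Type*} [Finite ι] {A B : ι → Type*} [∀ i, AddCommGroup (A i)]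
    [∀ i, Module R (A i)] [∀ i, AddCommGroup (B i)] [∀ i, Module R (B i)]
    {d : ∀ i, A i →ₗ[R] B i} (h : ∀ i, IsExtensible (d i) Z) :
    IsExtensible (LinearMap.piMap d) Z := by
  classical
  cases nonempty_fintype ι
  intro a
  choose b hb using fun i => h i (a ∘ₗ LinearMap.single R A i)
  refine ⟨LinearMap.lsum R B ℕ b, ?_⟩
  refine LinearMap.pi_ext' fun i => ?_
  rw [← hb i]
  ext x
  simp only [LinearMap.comp_apply, LinearMap.lsum_apply, LinearMap.sum_apply, LinearMap.proj_apply,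
    LinearMap.coe_single]
  rw [Finset.sum_eq_single i]
  · simp
  · intro j _ hj
    simp [Pi.single_eq_of_ne hj]
  · simp

theorem IsExtensible.prodMap {A₁ A₀ : Type*} [AddCommGroup A₁] [Module R A₁] [AddCommGroup A₀]
    [Module R A₀] {d : Q₁ →ₗ[R] Q₀} {d' : A₁ →ₗ[R] A₀} (h : IsExtensible d Z)
    (h' : IsExtensible d' Z) : IsExtensible (d.prodMap d') Z := by
  intro a
  obtain ⟨b, hb⟩ := h (a ∘ₗ LinearMap.inl R _ _)
  obtain ⟨c, hc⟩ := h' (a ∘ₗ LinearMap.inr R _ _)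
  refine ⟨b.coprod c, ?_⟩
  ext x
  · simpa using LinearMap.congr_fun hb x
  · simpa using LinearMap.congr_fun hc x

theorem exact_piMap {ι : Type*} {A B C : ι → Type*} [∀ i, AddCommGroup (A i)]
    [∀ i, Module R (A i)] [∀ i, AddCommGroup (B i)] [∀ i, Module R (B i)]
    [∀ i, AddCommGroup (C i)] [∀ i, Module R (C i)]
    {d : ∀ i, A i →ₗ[R] B i} {p : ∀ i, B i →ₗ[R] C i} (h : ∀ i, Function.Exact (d i) (p i)) :
    Function.Exact (LinearMap.piMap d) (LinearMap.piMap p) := by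
  intro y
  constructor
  · intro hy
    choose x hx using fun i => (h i (y i)).1 (congrFun hy i)
    exact ⟨x, funext hx⟩
  · rintro ⟨x, rfl⟩
    exact funext fun i => (h i).apply_apply_eq_zero (x i)

theorem IsGenerated.of_surjective (h : IsGenerated R X Y) {f : Y →ₗ[R] Z}
    (hf : Function.Surjective f) : IsGenerated R X Z := by
  obtain ⟨q, g, hg⟩ := h
  exact ⟨q, f ∘ₗ g, hf.comp hg⟩

theorem IsGenerated.refl : IsGenerated R X X :=
  ⟨1, LinearMap.proj 0, fun x => ⟨fun _ => x, rfl⟩⟩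

theorem IsGenerated.of_isRetract (h : IsRetract R Z X) : IsGenerated R X Z := by
  obtain ⟨i, r, h⟩ := h
  exact IsGenerated.refl.of_surjective (f := r) fun x => ⟨i x, LinearMap.congr_fun h x⟩

end Presentations

/-! ### Dimensions of homomorphism spaces. -/

section HomDim

variable (k : Type u) [Field k] {R : Type*} [Ring R] [Algebra k R]
  {X Y Z P Q₁ Q₀ : Type*} [AddCommGroup X] [Module R X]
  [AddCommGroup Y] [Module R Y] [AddCommGroup P] [Module R P]
  [AddCommGroup Q₁] [Module R Q₁] [AddCommGroup Q₀] [Module R Q₀]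
  {Z' Z'' : Type*} [AddCommGroup Z] [Module R Z] [Module k Z] [IsScalarTower k R Z]
  [AddCommGroup Z'] [Module R Z'] [Module k Z'] [IsScalarTower k R Z']
  [AddCommGroup Z''] [Module R Z''] [Module k Z''] [IsScalarTower k R Z'']

/-- The dimension of `Hom_R(X, Z)` over `k`. -/
noncomputable def homDim (R : Type*) [Ring R] [Algebra k R] (X Z : Type*) [AddCommGroup X]
    [Module R X] [AddCommGroup Z] [Module R Z] [Module k Z] [IsScalarTower k R Z] : ℕ :=
  Module.finrank k (X →ₗ[R] Z)

/-- Composition with `f` on the right, as a `k`-linear map. -/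
def precomp (f : X →ₗ[R] Y) (Z : Type*) [AddCommGroup Z] [Module R Z] [Module k Z]
    [IsScalarTower k R Z] : (Y →ₗ[R] Z) →ₗ[k] (X →ₗ[R] Z) where
  toFun g := g ∘ₗ f
  map_add' _ _ := rfl
  map_smul' _ _ := rfl

/-- Composition with `g` on the left, as a `k`-linear map. -/
def postcomp (X : Type*) [AddCommGroup X] [Module R X] (g : Z →ₗ[R] Z') :
    (X →ₗ[R] Z) →ₗ[k] (X →ₗ[R] Z') where
  toFun f := g ∘ₗ f
  map_add' _ _ := LinearMap.comp_add _ _ _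
  map_smul' c f := by
    ext x
    exact g.map_smul_of_tower c (f x)

/-- A homomorphism is determined by its values on generators. The dimension counts need this
finiteness, as `Module.finrank` is zero on infinite-dimensional spaces. -/
theorem finite_hom [Module.Finite R X] [Module.Finite k Z] : Module.Finite k (X →ₗ[R] Z) := by
  obtain ⟨n, f, hf⟩ := Module.Finite.exists_fin' R X
  let F : (X →ₗ[R] Z) →ₗ[k] (Fin n → Z) :=
    { toFun := fun g i => g (f (Pi.single i 1))
      map_add' := fun _ _ => rfl
      map_smul' := fun _ _ => rfl }
  refine Module.Finite.of_injective F fun g h hgh => ?_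
  have : g ∘ₗ f = h ∘ₗ f := by
    refine LinearMap.pi_ext' fun i => ?_
    ext
    exact congrFun hgh i
  ext x
  obtain ⟨y, rfl⟩ := hf x
  exact LinearMap.congr_fun this y

theorem homDim_congr_left (e : X ≃ₗ[R] Y) : homDim k R X Z = homDim k R Y Z :=
  LinearEquiv.finrank_eq (LinearEquiv.ofLinearMap (precomp k e.symm.toLinearMap Z)
    (precomp k e.toLinearMap Z) (by ext; simp [precomp]) (by ext; simp [precomp]))

theorem homDim_congr_right (e : Z ≃ₗ[R] Z') : homDim k R X Z = homDim k R X Z' :=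
  LinearEquiv.finrank_eq (LinearEquiv.ofLinearMap (postcomp k X e.toLinearMap)
    (postcomp k X e.symm.toLinearMap) (by ext; simp [postcomp]) (by ext; simp [postcomp]))

theorem homDim_of_subsingleton [Subsingleton X] : homDim k R X Z = 0 := by
  have : Subsingleton (X →ₗ[R] Z) := ⟨fun f g => by
    ext x; rw [Subsingleton.elim x 0, map_zero, map_zero]⟩
  exact Module.finrank_zero_of_subsingleton

theorem homDim_prod [Module.Finite R X] [Module.Finite R Y] [Module.Finite k Z] :
    homDim k R (X × Y) Z = homDim k R X Z + homDim k R Y Z := by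
  have := finite_hom k (R := R) (X := X) (Z := Z)
  have := finite_hom k (R := R) (X := Y) (Z := Z)
  rw [homDim, homDim, homDim, ← Module.finrank_prod]
  exact (LinearMap.coprodEquiv k).finrank_eq.symm

theorem homDim_pi [Module.Finite R X] [Module.Finite k Z] (m : ℕ) :
    homDim k R (Fin m → X) Z = m * homDim k R X Z := by
  have := finite_hom k (R := R) (X := X) (Z := Z)
  rw [homDim, homDim, ← (LinearMap.lsum R (fun _ : Fin m => X) k (M := Z)).finrank_eq,
    Module.finrank_pi_fintype]
  simp

theorem homDim_le_of_injective [Module.Finite R X] [Module.Finite k Z'] {g : Z →ₗ[R] Z'}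
    (hg : Function.Injective g) : homDim k R X Z ≤ homDim k R X Z' := by
  have := finite_hom k (R := R) (X := X) (Z := Z')
  refine LinearMap.finrank_le_finrank_of_injective (f := postcomp k X g) fun a b hab => ?_
  ext x
  exact hg (LinearMap.congr_fun hab x)

/-- If all homomorphisms `X → Z'` have their image in the submodule `Z` because the dimensions
agree, the identification of the homomorphism spaces is onto. -/
theorem exists_comp_eq_of_homDim_eq [Module.Finite R X] [Module.Finite k Z']
    {g : Z →ₗ[R] Z'} (hg : Function.Injective g) (h : homDim k R X Z = homDim k R X Z')
    (f : X →ₗ[R] Z') : ∃ f' : X →ₗ[R] Z, g ∘ₗ f' = f := by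
  have := finite_hom k (R := R) (X := X) (Z := Z')
  have hinj : Function.Injective (postcomp k X g) := fun a b hab => by
    ext x
    exact hg (LinearMap.congr_fun hab x)
  have := Module.Finite.of_injective _ hinj
  exact (LinearMap.injective_iff_surjective_of_finrank_eq_finrank h).1 hinj f

theorem homDim_eq_of_forall_exists [Module.Finite R X] [Module.Finite k Z']
    {g : Z →ₗ[R] Z'} (hg : Function.Injective g)
    (h : ∀ f : X →ₗ[R] Z', ∃ f' : X →ₗ[R] Z, g ∘ₗ f' = f) :
    homDim k R X Z = homDim k R X Z' := by
  refine LinearEquiv.finrank_eq (LinearEquiv.ofBijective (postcomp k X g) ⟨fun a b hab => ?_, h⟩)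
  ext x
  exact hg (LinearMap.congr_fun hab x)

/-- The sequence 0 → Hom(X, Z) → Hom(Q₀, Z) → Hom(Q₁, Z) is always exact; extensibility is
surjectivity of its last map. -/
theorem homDim_of_isExtensible [Module.Finite R Q₁] [Module.Finite R Q₀] [Module.Finite k Z]
    {d : Q₁ →ₗ[R] Q₀} {p : Q₀ →ₗ[R] X} (hp : Function.Surjective p) (hdp : Function.Exact d p)
    (h : IsExtensible d Z) : homDim k R Q₀ Z = homDim k R X Z + homDim k R Q₁ Z := by
  have := finite_hom k (R := R) (X := Q₁) (Z := Z)
  have := finite_hom k (R := R) (X := Q₀) (Z := Z)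
  have hinj : Function.Injective (precomp k p Z) := fun a b hab => by
    ext x
    obtain ⟨y, rfl⟩ := hp x
    exact LinearMap.congr_fun hab y
  have hker : LinearMap.ker (precomp k d Z) = LinearMap.range (precomp k p Z) := by
    ext f
    constructor
    · intro hf
      have hf' : LinearMap.ker p ≤ LinearMap.ker f := fun x hx => by
        obtain ⟨y, rfl⟩ := (hdp x).1 hx
        exact LinearMap.congr_fun hf y
      refine ⟨(LinearMap.ker p).liftQ f hf' ∘ₗ
        (p.quotKerEquivOfSurjective hp).symm.toLinearMap, ?_⟩
      ext x
      have : (p.quotKerEquivOfSurjective hp).symm (p x) = (LinearMap.ker p).mkQ x := by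
        rw [LinearEquiv.symm_apply_eq]; rfl
      simp [precomp, this]
    · rintro ⟨g, rfl⟩
      ext x
      simp [precomp, hdp.apply_apply_eq_zero]
  have hr : LinearMap.range (precomp k d Z) = ⊤ := LinearMap.range_eq_top.2 h
  have e := LinearMap.finrank_range_add_finrank_ker (precomp k d Z)
  rw [hker, hr, finrank_top, LinearMap.finrank_range_of_inj hinj] at e
  rw [homDim, homDim, homDim, ← e, add_comm]

theorem homDim_of_projective [Module.Projective R P] [Module.Finite R P] [Module.Finite k Z]
    {i : Z' →ₗ[R] Z} {g : Z →ₗ[R] Z''} (hi : Function.Injective i) (hg : Function.Surjective g)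
    (hig : Function.Exact i g) :
    homDim k R P Z = homDim k R P Z' + homDim k R P Z'' := by
  have := finite_hom k (R := R) (X := P) (Z := Z)
  have hinj : Function.Injective (postcomp k P i) := fun a b hab => by
    ext x
    exact hi (LinearMap.congr_fun hab x)
  have hker : LinearMap.ker (postcomp k P g) = LinearMap.range (postcomp k P i) := by
    ext f
    constructor
    · exact fun hf => exists_lift_of_exact hig f hf
    · rintro ⟨h, rfl⟩
      ext x
      simp [postcomp, hig.apply_apply_eq_zero]
  have hr : LinearMap.range (postcomp k P g) = ⊤ :=
    LinearMap.range_eq_top.2 fun f => Module.projective_lifting_property g f hg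
  have e := LinearMap.finrank_range_add_finrank_ker (postcomp k P g)
  rw [hker, hr, finrank_top, LinearMap.finrank_range_of_inj hinj] at e
  rw [homDim, homDim, homDim, ← e, add_comm]

end HomDim

/-! ### Generated modules and traces. -/

section Trace

variable {R : Type*} [Ring R] {M Z Z' : Type*} [AddCommGroup M] [Module R M]
  [AddCommGroup Z] [Module R Z] [AddCommGroup Z'] [Module R Z']

theorem isGenerated_of_fintype {κ : Type*} [Finite κ] {f : (κ → M) →ₗ[R] Z}
    (hf : Function.Surjective f) : IsGenerated R M Z := by
  cases nonempty_fintype κ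
  let e := LinearEquiv.funCongrLeft R M (Fintype.equivFin κ)
  exact ⟨_, f ∘ₗ e.toLinearMap, hf.comp e.surjective⟩

theorem isGenerated_sup {U V : Submodule R Z} (hU : IsGenerated R M U) (hV : IsGenerated R M V) :
    IsGenerated R M ↥(U ⊔ V) := by
  obtain ⟨q, f, hf⟩ := hU
  obtain ⟨r, g, hg⟩ := hV
  let e := LinearEquiv.sumArrowLequivProdArrow (Fin q) (Fin r) R M
  let F := (Submodule.inclusion (le_sup_left : U ≤ U ⊔ V) ∘ₗ f).coprod
    (Submodule.inclusion (le_sup_right : V ≤ U ⊔ V) ∘ₗ g)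
  have hF : Function.Surjective F := by
    rintro ⟨z, hz⟩
    obtain ⟨y, hy, x, hx, rfl⟩ := Submodule.mem_sup.1 hz
    obtain ⟨a, ha⟩ := hf ⟨y, hy⟩
    obtain ⟨b, hb⟩ := hg ⟨x, hx⟩
    refine ⟨(a, b), Subtype.ext ?_⟩
    simp [F, ha, hb]
  exact isGenerated_of_fintype (f := F ∘ₗ e.toLinearMap) (hF.comp e.surjective)

/-- A trace is a sum over infinitely many homomorphisms. A maximal generated submodule below the
supremum exists by noetherianity and absorbs every `W i`. -/
theorem isGenerated_iSup [IsNoetherian R Z] {κ : Sort*} {W : κ → Submodule R Z}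
    (h : ∀ i, IsGenerated R M (W i)) : IsGenerated R M ↥(⨆ i, W i) := by
  obtain ⟨V, ⟨hV, hVg⟩, hmax⟩ := set_has_maximal_iff_noetherian.2 ‹IsNoetherian R Z›
    {V | V ≤ ⨆ i, W i ∧ IsGenerated R M V}
    ⟨⊥, bot_le, 0, 0, fun x => ⟨0, Subsingleton.elim _ _⟩⟩
  have : ⨆ i, W i = V := by
    refine le_antisymm (iSup_le fun i => ?_) hV
    have := hmax (V ⊔ W i) ⟨sup_le hV (le_iSup W i), isGenerated_sup hVg (h i)⟩
    by_contra hle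
    exact this (left_lt_sup.2 hle)
  rwa [this]

variable (R) {ι : Type*} (T : ι → Type*) [∀ i, AddCommGroup (T i)] [∀ i, Module R (T i)]

/-- The sum of the images of all homomorphisms from the modules `T i`, `i ∈ s`, to `Z`. -/
def traceOf (s : Finset ι) (Z : Type*) [AddCommGroup Z] [Module R Z] : Submodule R Z :=
  ⨆ (i : ι) (_ : i ∈ s) (f : T i →ₗ[R] Z), LinearMap.range f

variable {R T}

theorem range_le_traceOf {s : Finset ι} {i : ι} (hi : i ∈ s) (f : T i →ₗ[R] Z) :
    LinearMap.range f ≤ traceOf R T s Z :=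
  le_iSup_of_le i (le_iSup_of_le hi (le_iSup (fun f : T i →ₗ[R] Z => LinearMap.range f) f))

theorem traceOf_le {s : Finset ι} {W : Submodule R Z}
    (h : ∀ i ∈ s, ∀ f : T i →ₗ[R] Z, LinearMap.range f ≤ W) : traceOf R T s Z ≤ W :=
  iSup_le fun i => iSup_le fun hi => iSup_le fun f => h i hi f

theorem map_traceOf_le (s : Finset ι) (g : Z →ₗ[R] Z') :
    (traceOf R T s Z).map g ≤ traceOf R T s Z' := by
  rw [Submodule.map_le_iff_le_comap]
  refine traceOf_le fun i hi f => ?_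
  rw [← Submodule.map_le_iff_le_comap, ← LinearMap.range_comp]
  exact range_le_traceOf hi (g ∘ₗ f)

theorem isGenerated_traceOf [IsNoetherian R Z] {s : Finset ι}
    (h : ∀ i ∈ s, IsGenerated R M (T i)) : IsGenerated R M (traceOf R T s Z) :=
  isGenerated_iSup fun i => isGenerated_iSup fun hi => isGenerated_iSup fun f =>
    (h i hi).of_surjective f.surjective_rangeRestrict

end Trace

/-! ### Linear independence of the functions dim Hom(X, −). -/

section LinearIndependence

variable {k : Type u} [Field k] {R : Type*} [Ring R] [Algebra k R]

theorem mem_jacobson_of_not_isUnit {T : Type*} [AddCommGroup T] [Module R T] [IsNoetherian R T]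
    [IsArtinian R T] (hT : IsIndecomposable R T) {f : Module.End R T} (hf : ¬ IsUnit f) :
    f ∈ Ring.jacobson (Module.End R T) := by
  rw [← Ideal.jacobson_bot, Ideal.mem_jacobson_iff]
  intro y
  have h1 : ¬ IsUnit (y * f) := fun h => hf (isUnit_right_of_isUnit_mul h)
  have h2 := ((hT.isUnit_or_isNilpotent _).resolve_left h1).isUnit_add_one
  obtain ⟨z, hz⟩ := h2.exists_left_inv
  refine ⟨z, ?_⟩
  rw [Ideal.mem_bot, sub_eq_zero, ← hz, mul_add, mul_one, mul_assoc]

/-- Nakayama's lemma over the local ring `End T`. -/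
theorem eq_top_of_sup_range_eq_top {T : Type*} [AddCommGroup T] [Module R T] [IsNoetherian R T]
    [IsArtinian R T] [Module k T] [IsScalarTower k R T] [Module.Finite k T]
    (hT : IsIndecomposable R T) (W : Submodule R T)
    (hW : ∀ f : Module.End R T, W.map f ≤ W)
    (h : W ⊔ ⨆ f : {f : Module.End R T // ¬ IsUnit f}, LinearMap.range f.1 = ⊤) : W = ⊤ := by
  -- Stability under endomorphisms makes `W` an `End T`-submodule. Non-units lie in the radical of
  -- `End T`, so the hypothesis says that the radical maps `T ⧸ W'` onto itself.
  let W' : Submodule (Module.End R T) T :=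
    { carrier := W
      add_mem' := W.add_mem
      zero_mem' := W.zero_mem
      smul_mem' := fun f x hx => hW f ⟨x, hx, rfl⟩ }
  have : IsScalarTower k (Module.End R T) T := ⟨fun _ _ _ => rfl⟩
  have : Module.Finite (Module.End R T) T := Module.Finite.of_restrictScalars_finite k _ T
  have hbot : (⊤ : Submodule (Module.End R T) (T ⧸ W')) = ⊥ := by
    refine Submodule.FG.eq_bot_of_le_jacobson_smul Module.Finite.fg_top fun z _ => ?_
    obtain ⟨x, rfl⟩ := W'.mkQ_surjective z
    obtain ⟨y, hy, x', hx', rfl⟩ := Submodule.mem_sup.1 (h ▸ Submodule.mem_top (x := x))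
    rw [map_add, show W'.mkQ y = 0 from (Submodule.Quotient.mk_eq_zero W').2 hy, zero_add]
    refine Submodule.iSup_induction _ (motive := fun x => W'.mkQ x ∈ _) hx' ?_ ?_ ?_
    · rintro f _ ⟨t, rfl⟩
      exact Submodule.smul_mem_smul (mem_jacobson_of_not_isUnit hT f.2)
        (Submodule.mem_top (x := W'.mkQ t))
    · rw [map_zero]
      exact Submodule.zero_mem _
    · intro a b ha hb
      rw [map_add]
      exact Submodule.add_mem _ ha hb
  refine eq_top_iff.2 fun x _ => ?_
  exact (Submodule.Quotient.mk_eq_zero W').1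
    ((Submodule.mem_bot _).1 (hbot ▸ Submodule.mem_top (x := W'.mkQ x)))

variable {ι : Type*} {T : ι → Type*} [∀ i, AddCommGroup (T i)] [∀ i, Module R (T i)]
  [∀ i, IsNoetherian R (T i)] [∀ i, IsArtinian R (T i)]
  [∀ i, Module k (T i)] [∀ i, IsScalarTower k R (T i)] [∀ i, Module.Finite k (T i)]

/-- `T u` is generated by `t`, hence by `T u` and `s` through the modules of `t`. A composition T u
→ T b → T u is not a unit, since otherwise `T b` would be isomorphic to `T u`. By Nakayama these
endomorphisms can be dropped. -/
theorem traceOf_eq_top_of_insert (k : Type u) [Field k] [Algebra k R]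
    [∀ i, Module k (T i)] [∀ i, IsScalarTower k R (T i)] [∀ i, Module.Finite k (T i)]
    [DecidableEq ι] (hT : ∀ i, IsIndecomposable R (T i))
    (hne : ∀ i j, Nonempty (T i ≃ₗ[R] T j) → i = j) {s t : Finset ι} {u : ι} (hu : u ∉ t)
    (h1 : traceOf R T t (T u) = ⊤) (h2 : ∀ b ∈ t, traceOf R T (insert u s) (T b) = ⊤) :
    traceOf R T s (T u) = ⊤ := by
  refine eq_top_of_sup_range_eq_top (k := k) (hT u) _ (fun f => map_traceOf_le s f) ?_
  refine top_le_iff.1 (h1.symm.le.trans (traceOf_le fun b hb f => ?_))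
  rw [← Submodule.map_top, ← h2 b hb, Submodule.map_le_iff_le_comap]
  refine traceOf_le fun i hi g => ?_
  rw [← Submodule.map_le_iff_le_comap, ← LinearMap.range_comp]
  rcases Finset.mem_insert.1 hi with rfl | hi
  · refine le_sup_of_le_right (le_iSup_of_le ⟨f ∘ₗ g, fun h => hu ?_⟩ le_rfl)
    obtain ⟨e⟩ := (hT b).equiv_of_isRetract (hT i).1 (IsRetract.of_isUnit h)
    rwa [hne _ _ ⟨e⟩]
  · exact le_sup_of_le_left (range_le_traceOf hi (f ∘ₗ g))

/-- Two disjoint families cannot generate each other: the members of `s` are removed one at a time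
by `traceOf_eq_top_of_insert`, until the empty family would generate the nonzero modules of `t`. -/
theorem eq_empty_of_traceOf (k : Type u) [Field k] [Algebra k R]
    [∀ i, Module k (T i)] [∀ i, IsScalarTower k R (T i)] [∀ i, Module.Finite k (T i)]
    (hT : ∀ i, IsIndecomposable R (T i))
    (hne : ∀ i j, Nonempty (T i ≃ₗ[R] T j) → i = j) {s t : Finset ι} (hst : Disjoint s t)
    (h1 : ∀ a ∈ s, traceOf R T t (T a) = ⊤) (h2 : ∀ b ∈ t, traceOf R T s (T b) = ⊤) : t = ∅ := by
  classical
  suffices H : ∀ s' ⊆ s, (∀ b ∈ t, traceOf R T s' (T b) = ⊤) → t = ∅ from H s subset_rfl h2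
  intro s'
  induction s' using Finset.induction_on with
  | empty =>
    intro _ h
    refine Finset.eq_empty_of_forall_notMem fun b hb => ?_
    have h0 : traceOf R T ∅ (T b) ≤ ⊥ := traceOf_le fun i hi => absurd hi (Finset.notMem_empty i)
    have := (hT b).1
    rw [h b hb] at h0
    exact bot_ne_top (le_antisymm bot_le h0)
  | insert u s' hu ih =>
    intro hs h
    have hus := hs (Finset.mem_insert_self u s')
    refine ih ((Finset.subset_insert u s').trans hs) fun b hb => ?_
    have key := traceOf_eq_top_of_insert k hT hne
      (Finset.disjoint_left.1 hst hus) (h1 u hus) h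
    rw [← top_le_iff, ← h b hb]
    refine traceOf_le fun i hi g => ?_
    rcases Finset.mem_insert.1 hi with rfl | hi
    · rw [← Submodule.map_top, ← key]
      exact map_traceOf_le s' g
    · exact range_le_traceOf hi g

omit [∀ i, IsArtinian R (T i)] in
-- Let Z be the trace of `t` in `T a`. Passing from `T a` to Z leaves the right-hand sum unchanged
-- and cannot increase any term on the left, so equality of the sums forces equality of the terms.
-- In particular Hom(T a, Z) = End(T a), and the identity of `T a` factors through Z.
theorem traceOf_eq_top_of_homDim [∀ i, Module.Finite R (T i)]
    {M : Type*} [AddCommGroup M] [Module R M]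
    (hM : ∀ i, IsGenerated R M (T i)) {s t : Finset ι} {c : ι → ℚ} (hs : ∀ i ∈ s, 0 < c i)
    {a : ι} (ha : a ∈ s)
    (h : ∀ Z : Submodule R (T a), IsGenerated R M Z →
      ∑ i ∈ s, c i * homDim k R (T i) Z = ∑ i ∈ t, c i * homDim k R (T i) Z) :
    traceOf R T t (T a) = ⊤ := by
  set Z := traceOf R T t (T a) with hZ
  have hfin : Module.Finite k Z :=
    Module.Finite.of_injective (Z.subtype.restrictScalars k) Z.injective_subtype
  have e1 := h Z (isGenerated_traceOf fun i _ => hM i)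
  have e2 := h ⊤ ((hM a).of_surjective (f := Submodule.topEquiv.symm.toLinearMap)
    Submodule.topEquiv.symm.surjective)
  simp only [fun i => homDim_congr_right k (X := T i) (Submodule.topEquiv (R := R) (M := T a))]
    at e2
  have e3 : ∀ i ∈ t, homDim k R (T i) Z = homDim k R (T i) (T a) := fun i hi =>
    homDim_eq_of_forall_exists k Z.injective_subtype fun f =>
      ⟨f.codRestrict Z fun x => range_le_traceOf hi f ⟨x, rfl⟩, by ext; rfl⟩
  have e7 : ∑ i ∈ t, c i * (homDim k R (T i) Z : ℚ) = ∑ i ∈ t, c i * homDim k R (T i) (T a) :=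
    Finset.sum_congr rfl fun i hi => by rw [e3 i hi]
  rw [e7, ← e2] at e1
  have e4 : ∀ i ∈ s, c i * homDim k R (T i) Z ≤ c i * homDim k R (T i) (T a) := fun i hi =>
    mul_le_mul_of_nonneg_left (by exact_mod_cast homDim_le_of_injective k Z.injective_subtype)
      (hs i hi).le
  have e5 := (Finset.sum_eq_sum_iff_of_le e4).1 e1 a ha
  have e6 : homDim k R (T a) Z = homDim k R (T a) (T a) := by
    exact_mod_cast mul_left_cancel₀ (hs a ha).ne' e5
  obtain ⟨f, hf⟩ := exists_comp_eq_of_homDim_eq k Z.injective_subtype e6 LinearMap.id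
  refine eq_top_iff.2 fun x _ => ?_
  have : ((f x : Z) : T a) = x := LinearMap.congr_fun hf x
  rw [← this]
  exact (f x).2

/-- The quotients of the finite direct sums of copies of `M`. -/
abbrev QuotientIndex (R : Type*) [Ring R] (M : Type*) [AddCommGroup M] [Module R M] : Type _ :=
  Σ q : ℕ, Submodule R (Fin q → M)

/-- The function `Z ↦ dim Hom(X, Z)` on the modules generated by `M`. -/
noncomputable def homFun (k : Type u) [Field k] (R : Type*) [Ring R] [Algebra k R] (M : Type*)
    [AddCommGroup M] [Module R M] [Module k M] [IsScalarTower k R M] (X : Type*) [AddCommGroup X] [Module R X] :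
    QuotientIndex R M → ℚ :=
  fun I => homDim k R X ((Fin I.1 → M) ⧸ I.2)

variable {M : Type*} [AddCommGroup M] [Module R M] [Module k M] [IsScalarTower k R M]

theorem IsGenerated.exists_index {M : Type*} [AddCommGroup M] [Module R M]
    {Z : Type*} [AddCommGroup Z] [Module R Z] (h : IsGenerated R M Z) :
    ∃ I : QuotientIndex R M, Nonempty (((Fin I.1 → M) ⧸ I.2) ≃ₗ[R] Z) := by
  obtain ⟨q, f, hf⟩ := h
  exact ⟨⟨q, LinearMap.ker f⟩, ⟨f.quotKerEquivOfSurjective hf⟩⟩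

/-- The functions `Z ↦ dim Hom(T i, Z)` on the modules generated by `M` are linearly independent
for pairwise non-isomorphic indecomposable modules `T i` generated by `M`. -/
theorem linearIndependent_homFun [∀ i, Module.Finite R (T i)]
    (hM : ∀ i, IsGenerated R M (T i)) (hT : ∀ i, IsIndecomposable R (T i))
    (hne : ∀ i j, Nonempty (T i ≃ₗ[R] T j) → i = j) :
    LinearIndependent ℚ fun i => homFun k R M (T i) := by
  classical
  rw [linearIndependent_iff']
  intro s g hg
  -- Moving the negative coefficients to the other side turns a linear relation into an equality of
  -- two positive combinations with disjoint supports.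
  have hsum : ∀ (a : ι) (Z : Submodule R (T a)), IsGenerated R M Z →
      ∑ i ∈ s with 0 < g i, |g i| * homDim k R (T i) Z =
        ∑ i ∈ s with g i < 0, |g i| * homDim k R (T i) Z := by
    intro a Z hZ
    obtain ⟨I, ⟨e⟩⟩ := hZ.exists_index
    have hI : ∀ i, homFun k R M (T i) I = homDim k R (T i) Z := fun i =>
      congrArg Nat.cast (homDim_congr_right k e)
    have h0 := congrFun hg I
    simp only [Finset.sum_apply, Pi.smul_apply, smul_eq_mul, Pi.zero_apply, hI] at h0
    refine sub_eq_zero.1 (Eq.trans ?_ h0)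
    rw [Finset.sum_filter, Finset.sum_filter, ← Finset.sum_sub_distrib]
    refine Finset.sum_congr rfl fun i _ => ?_
    rcases lt_trichotomy (g i) 0 with h | h | h
    · rw [if_neg h.not_gt, if_pos h, abs_of_neg h]; ring
    · simp [h]
    · rw [if_pos h, if_neg h.not_gt, abs_of_pos h]; ring
  have hp : ∀ i ∈ s.filter (0 < g ·), 0 < |g i| := fun i hi =>
    abs_pos.2 (Finset.mem_filter.1 hi).2.ne'
  have hn : ∀ i ∈ s.filter (g · < 0), 0 < |g i| := fun i hi =>
    abs_pos.2 (Finset.mem_filter.1 hi).2.ne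
  have h1 : ∀ a ∈ s.filter (0 < g ·), traceOf R T (s.filter (g · < 0)) (T a) = ⊤ := fun a ha =>
    traceOf_eq_top_of_homDim (k := k) hM hp ha (hsum a)
  have h2 : ∀ a ∈ s.filter (g · < 0), traceOf R T (s.filter (0 < g ·)) (T a) = ⊤ := fun a ha =>
    traceOf_eq_top_of_homDim (k := k) hM hn ha fun Z hZ => (hsum a Z hZ).symm
  have hd : Disjoint (s.filter (0 < g ·)) (s.filter (g · < 0)) :=
    Finset.disjoint_filter.2 fun i _ h h' => h.not_gt h'
  have e1 := eq_empty_of_traceOf k hT hne hd h1 h2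
  have e2 := eq_empty_of_traceOf k hT hne hd.symm h2 h1
  intro i hi
  refine le_antisymm (not_lt.1 fun h => ?_) (not_lt.1 fun h => ?_)
  · exact Finset.notMem_empty i (e2 ▸ Finset.mem_filter.2 ⟨hi, h⟩)
  · exact Finset.notMem_empty i (e1 ▸ Finset.mem_filter.2 ⟨hi, h⟩)

end LinearIndependence

/-! ### Indecomposable projectives and the bound on the number of summands. -/

section ProjectiveSystems

/-- `P` is a complete list of the indecomposable finitely generated projective modules. -/
structure IsProjectiveSystem (R : Type*) [Ring R] {n : ℕ} (P : Fin n → Type*)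
    [∀ j, AddCommGroup (P j)] [∀ j, Module R (P j)] : Prop where
  finite : ∀ j, Module.Finite R (P j)
  projective : ∀ j, Module.Projective R (P j)
  indecomposable : ∀ j, IsIndecomposable R (P j)
  eq_of_equiv : ∀ i j, Nonempty (P i ≃ₗ[R] P j) → i = j
  isRetract : IsRetract R R (Π j, P j)

variable (k : Type u) [Field k] {R : Type v} [Ring R] [Algebra k R] [IsArtinianRing R]
  {n : ℕ} {P : Fin n → Type*} [∀ j, AddCommGroup (P j)] [∀ j, Module R (P j)]

theorem IsProjectiveSystem.exists_equiv (hP : IsProjectiveSystem R P) {U : Type*} [AddCommGroup U]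
    [Module R U] [Module.Finite R U] [Module.Projective R U] (hU : IsIndecomposable R U) :
    ∃ j, Nonempty (U ≃ₗ[R] P j) := by
  have := hP.finite
  obtain ⟨m, f, hf⟩ := Module.Finite.exists_fin' R U
  obtain ⟨g, hg⟩ := Module.projective_lifting_property f LinearMap.id hf
  have h1 : IsRetract R U (Fin m → R) := ⟨g, f, hg⟩
  obtain ⟨_, h2⟩ := hU.exists_isRetract h1
  obtain ⟨j, h3⟩ := hU.exists_isRetract (h2.trans hP.isRetract)
  exact ⟨j, (hP.indecomposable j).equiv_of_isRetract hU.1 h3⟩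

/-- The sum of two disjoint submodules is their direct sum. -/
noncomputable def prodEquivSup {R X : Type*} [Ring R] [AddCommGroup X] [Module R X]
    {U V : Submodule R X} (h : Disjoint U V) : (U × V) ≃ₗ[R] ↥(U ⊔ V) :=
  LinearEquiv.ofBijective ((Submodule.inclusion le_sup_left).coprod
    (Submodule.inclusion le_sup_right)) <| by
      constructor
      · rw [← LinearMap.ker_eq_bot, LinearMap.ker_eq_bot']
        rintro ⟨⟨a, ha⟩, ⟨b, hb⟩⟩ hab
        have hab' : a + b = 0 := congrArg Subtype.val hab
        have h0 : a = 0 := Submodule.disjoint_def.1 h a ha (by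
          rw [eq_neg_of_add_eq_zero_left hab']; exact V.neg_mem hb)
        subst h0
        simp only [zero_add] at hab'
        subst hab'
        rfl
      · rintro ⟨z, hz⟩
        obtain ⟨y, hy, x, hx, rfl⟩ := Submodule.mem_sup.1 hz
        exact ⟨(⟨y, hy⟩, ⟨x, hx⟩), rfl⟩

variable {M : Type*} [AddCommGroup M] [Module R M] [Module k M] [IsScalarTower k R M]
  [Module.Finite k M]

omit [IsArtinianRing R] in
theorem finite_quotientIndex (I : QuotientIndex R M) : Module.Finite k ((Fin I.1 → M) ⧸ I.2) :=
  Module.Finite.of_surjective (I.2.mkQ.restrictScalars k) I.2.mkQ_surjective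

omit [IsArtinianRing R] [Module.Finite k M] in
theorem homFun_congr {X Y : Type*} [AddCommGroup X] [Module R X] [AddCommGroup Y] [Module R Y]
    (e : X ≃ₗ[R] Y) : homFun k R M X = homFun k R M Y :=
  funext fun _ => congrArg Nat.cast (homDim_congr_left k e)

/-- If `homFun U` lies in a subspace for all indecomposable direct summands `U` of `X`, then so
does `homFun X`. -/
theorem homFun_mem_of_isIndecomposable {X : Type*} [AddCommGroup X] [Module R X]
    [Module.Finite R X] (W : Submodule ℚ (QuotientIndex R M → ℚ))
    (h : ∀ U : Submodule R X, IsRetract R U X → IsIndecomposable R U → homFun k R M U ∈ W) :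
    homFun k R M X ∈ W := by
  have key := induction_on_isIndecomposable (R := R) (X := X)
    (fun U => homFun k R M U ∈ W) ?_ h ?_
  · rwa [homFun_congr k (Submodule.topEquiv (R := R) (M := X))] at key
  · have : homFun k R M (⊥ : Submodule R X) = 0 := funext fun I => by
      simp [homFun, homDim_of_subsingleton]
    rw [this]
    exact W.zero_mem
  · intro U V hUV hU hV
    have : homFun k R M ↥(U ⊔ V) = homFun k R M U + homFun k R M V := by
      rw [← homFun_congr k (prodEquivSup hUV)]
      funext I
      have := finite_quotientIndex k I
      simp [homFun, homDim_prod]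
    rw [this]
    exact W.add_mem hU hV

theorem IsProjectiveSystem.homFun_mem_span (hP : IsProjectiveSystem R P) (M : Type*)
    [AddCommGroup M] [Module R M] [Module k M] [IsScalarTower k R M]
    [Module.Finite k M] {U : Type*} [AddCommGroup U]
    [Module R U] [Module.Finite R U] [Module.Projective R U] :
    homFun k R M U ∈ Submodule.span ℚ (Set.range fun j => homFun k R M (P j)) := by
  refine homFun_mem_of_isIndecomposable k _ fun V hV hVi => ?_
  have := hV.projective
  have := hV.finite
  obtain ⟨j, ⟨e⟩⟩ := hP.exists_equiv hVi
  rw [homFun_congr k e]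
  exact Submodule.subset_span ⟨j, rfl⟩

omit [IsArtinianRing R] in
theorem homFun_of_isExtensible {X Q₁ Q₀ : Type*} [AddCommGroup X] [Module R X] [AddCommGroup Q₁]
    [Module R Q₁] [AddCommGroup Q₀] [Module R Q₀] [Module.Finite R Q₁] [Module.Finite R Q₀]
    [Module.Projective R Q₁]
    {d : Q₁ →ₗ[R] Q₀} {p : Q₀ →ₗ[R] X} (hp : Function.Surjective p) (hdp : Function.Exact d p)
    (h : IsExtensible d M) : homFun k R M Q₀ = homFun k R M X + homFun k R M Q₁ := by
  funext I
  have := finite_quotientIndex k I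
  have hI : IsExtensible d ((Fin I.1 → M) ⧸ I.2) :=
    h.of_isGenerated ⟨I.1, I.2.mkQ, I.2.mkQ_surjective⟩
  simp [homFun, homDim_of_isExtensible k hp hdp hI]

/-- `M` has a minimal projective presentation `P₁ → P₀` such that every homomorphism `P₁ → M`
factors through `P₀`. -/
def IsRigid (R : Type v) [Ring R] (M : Type w) [AddCommGroup M] [Module R M] : Prop :=
  ∃ π : MinimalPresentation R M, IsExtensible π.d M

theorem MinimalPresentation.isExtensible {X : Type w} [AddCommGroup X] [Module R X]
    (π : MinimalPresentation R X) {X' Q₁ Q₀ Z : Type*}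
    [AddCommGroup X'] [Module R X'] [AddCommGroup Q₁] [Module R Q₁] [AddCommGroup Q₀] [Module R Q₀]
    [AddCommGroup Z] [Module R Z] [Module.Projective R Q₁] [Module.Projective R Q₀]
    {d' : Q₁ →ₗ[R] Q₀} {p' : Q₀ →ₗ[R] X'} (hp' : Function.Surjective p')
    (hdp' : Function.Exact d' p') (hr : IsRetract R X X') (hZ : IsExtensible d' Z) :
    IsExtensible π.d Z :=
  IsExtensible.of_isRetract π.exact π.surjective π.superfluous₀ π.superfluous₁ hp' hdp' hr hZ

/-- The minimal presentation of `X` inherits extensibility to `M`, so the function of `X` is that of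
P₀ minus that of P₁. The coefficients obtained are those of the g-vector of `X`. -/
theorem IsProjectiveSystem.homFun_mem_span_of_isRigid (hP : IsProjectiveSystem R P) (M : Type*)
    [AddCommGroup M] [Module R M] [Module k M] [IsScalarTower k R M]
    [Module.Finite k M] [Module.Finite R M] (hM : IsRigid R M) {X : Type*} [AddCommGroup X]
    [Module R X] (hX : IsRetract R X M) :
    homFun k R M X ∈ Submodule.span ℚ (Set.range fun j => homFun k R M (P j)) := by
  have := hX.finite
  obtain ⟨ρ, hρ⟩ := hM
  obtain ⟨π⟩ := exists_minimalPresentation R X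
  have h := π.isExtensible ρ.surjective ρ.exact hX hρ
  rw [← add_sub_cancel_right (homFun k R M X) (homFun k R M π.P₁),
    ← homFun_of_isExtensible k π.surjective π.exact h]
  exact Submodule.sub_mem _ (hP.homFun_mem_span k M) (hP.homFun_mem_span k M)

/-- The functions of the distinct indecomposable summands are independent vectors in a space spanned
by `n` vectors. -/
theorem IsProjectiveSystem.numSummands_le (hP : IsProjectiveSystem R P) (M : Type w)
    [AddCommGroup M] [Module R M] [Module k M] [IsScalarTower k R M]
    [Module.Finite k M] [Module.Finite R M] (hM : IsRigid R M) : numSummands R M ≤ n := by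
  let T : Quotient (indecSummandSetoid R M) → Submodule R M := fun q => q.out.1
  have hret : ∀ q, IsRetract R (T q) M := fun q => by
    obtain ⟨V, hV⟩ := q.out.2.2
    exact .of_isCompl hV
  have : ∀ q, Module.Finite R (T q) := fun q => (hret q).finite
  have : ∀ q, Module.Finite k (T q) := fun q =>
    Module.Finite.of_injective ((T q).subtype.restrictScalars k) (T q).injective_subtype
  have hli : LinearIndependent ℚ fun q => homFun k R M (T q) :=
    linearIndependent_homFun (fun q => .of_isRetract (hret q)) (fun q => q.out.2.1)
      fun i j hij => by rw [← i.out_eq, ← j.out_eq]; exact Quotient.sound hij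
  have := Fintype.ofFinite (Set.range fun j => homFun k R M (P j))
  have hle : Set.range (fun q => homFun k R M (T q)) ≤
      Submodule.span ℚ (Set.range fun j => homFun k R M (P j)) := by
    rintro _ ⟨q, rfl⟩
    exact hP.homFun_mem_span_of_isRigid k M hM (hret q)
  have hfin := hli.finite_of_le_span_finite _ _ hle
  have := Fintype.ofFinite (Quotient (indecSummandSetoid R M))
  have h1 := linearIndependent_le_span_aux' _ hli _ hle
  rw [numSummands, ENat.card_eq_coe_fintype_card, Nat.cast_le]
  exact h1.trans ((Fintype.card_range_le _).trans (by simp))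

/-- A homomorphism from an indecomposable projective module to a simple quotient of another one
is zero. -/
theorem eq_zero_of_isSimpleModule {P P' S : Type*} [AddCommGroup P] [Module R P] [AddCommGroup P']
    [Module R P'] [AddCommGroup S] [Module R S] [Module.Finite R P] [Module.Finite R P']
    [Module.Projective R P] [Module.Projective R P'] (hP : IsIndecomposable R P)
    (hP' : IsIndecomposable R P') [IsSimpleModule R S] {π : P →ₗ[R] S} (hπ : π ≠ 0)
    (he : IsEmpty (P ≃ₗ[R] P')) (f : P' →ₗ[R] S) : f = 0 := by
  by_contra hf
  obtain ⟨g, hg⟩ := Module.projective_lifting_property π f (LinearMap.surjective_of_ne_zero hπ)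
  obtain ⟨h, hh⟩ := Module.projective_lifting_property f π (LinearMap.surjective_of_ne_zero hf)
  have e : π ∘ₗ (g ∘ₗ h) = π := by rw [← LinearMap.comp_assoc, hg, hh]
  -- Since π ≠ 0 is fixed by every power of `g ∘ₗ h`, this endomorphism is not nilpotent.
  have e' : ∀ m : ℕ, π ∘ₗ ((g ∘ₗ h : Module.End R P) ^ m) = π := fun m => by
    induction m with
    | zero => rfl
    | succ m ih => rw [pow_succ', Module.End.mul_eq_comp, ← LinearMap.comp_assoc, e, ih]
  rcases hP.isUnit_or_isNilpotent (g ∘ₗ h) with hu | ⟨m, hm⟩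
  · obtain ⟨e⟩ := hP'.equiv_of_isRetract hP.1 (IsRetract.of_isUnit hu)
    exact he.false e
  · exact hπ (by rw [← e' m, hm, LinearMap.comp_zero])

/-- The functions `homFun P` are linearly independent on the quotients of a sincere module. -/
theorem IsProjectiveSystem.linearIndependent (hP : IsProjectiveSystem R P) (M : Type*)
    [AddCommGroup M] [Module R M] [Module k M] [IsScalarTower k R M]
    [Module.Finite k M] (hM : ∀ j, ∃ f : P j →ₗ[R] M, f ≠ 0) :
    LinearIndependent ℚ fun j => homFun k R M (P j) := by
  rw [linearIndependent_iff']
  intro s g hg l hl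
  have := hP.finite
  have := hP.projective
  have hg' : ∀ K : Submodule R M, ∑ j ∈ s, g j * homDim k R (P j) (M ⧸ K) = 0 := fun K => by
    have hK : IsGenerated R M (M ⧸ K) := IsGenerated.refl.of_surjective K.mkQ_surjective
    obtain ⟨I, ⟨e⟩⟩ := hK.exists_index
    have h0 := congrFun hg I
    simp only [Finset.sum_apply, Pi.smul_apply, smul_eq_mul, Pi.zero_apply] at h0
    rw [← h0]
    refine Finset.sum_congr rfl fun i _ => ?_
    rw [← homDim_congr_right k e]
    rfl
  obtain ⟨f, hf⟩ := hM l
  -- The simple top of `P l` occurs as the subquotient L/N of `M`, which need not be generated by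
  -- `M`. Its dimensions are recovered as differences between the quotients M/N' and M/L, to which
  -- the relation applies.
  let L := LinearMap.range f
  have hL : Nontrivial L := Submodule.nontrivial_iff_ne_bot.2 (mt LinearMap.range_eq_bot.1 hf)
  have : Module.Finite R L := inferInstance
  obtain ⟨N, hN⟩ := IsCoatomic.exists_coatom (α := Submodule R L)
  have hS : IsSimpleModule R (L ⧸ N) := (isSimpleModule_iff_isCoatom).2 hN
  have hkL : Module.Finite k L :=
    Module.Finite.of_injective (L.subtype.restrictScalars k) L.injective_subtype
  have hkS : Module.Finite k (L ⧸ N) :=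
    Module.Finite.of_surjective (N.mkQ.restrictScalars k) N.mkQ_surjective
  let N' := N.map L.subtype
  have h1 : ∀ j, homDim k R (P j) M = homDim k R (P j) L + homDim k R (P j) (M ⧸ L) := fun j =>
    homDim_of_projective k L.injective_subtype L.mkQ_surjective (LinearMap.exact_subtype_mkQ L)
  have h2 : ∀ j, homDim k R (P j) M = homDim k R (P j) N' + homDim k R (P j) (M ⧸ N') := fun j =>
    homDim_of_projective k N'.injective_subtype N'.mkQ_surjective (LinearMap.exact_subtype_mkQ N')
  have h3 : ∀ j, homDim k R (P j) L = homDim k R (P j) N + homDim k R (P j) (L ⧸ N) := fun j =>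
    homDim_of_projective k N.injective_subtype N.mkQ_surjective (LinearMap.exact_subtype_mkQ N)
  have h4 : ∀ j, homDim k R (P j) N = homDim k R (P j) N' := fun j =>
    homDim_congr_right k (N.equivMapOfInjective _ L.injective_subtype)
  have h5 : ∑ j ∈ s, g j * homDim k R (P j) (L ⧸ N) = 0 := by
    have : ∀ j, (homDim k R (P j) (L ⧸ N) : ℚ) =
        homDim k R (P j) (M ⧸ N') - homDim k R (P j) (M ⧸ L) := fun j => by
      have e1 := h1 j
      rw [h2 j, h3 j, h4 j] at e1
      rw [eq_sub_iff_add_eq]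
      exact_mod_cast (by omega)
    simp only [this, mul_sub, Finset.sum_sub_distrib, hg', sub_self]
  have hπ : N.mkQ ∘ₗ f.rangeRestrict ≠ 0 := by
    intro h0
    have hsurj : Function.Surjective (N.mkQ ∘ₗ f.rangeRestrict) :=
      N.mkQ_surjective.comp f.surjective_rangeRestrict
    have hnt := IsSimpleModule.nontrivial R (L ⧸ N)
    obtain ⟨z, hz⟩ := exists_ne (0 : L ⧸ N)
    obtain ⟨y, rfl⟩ := hsurj z
    exact hz (LinearMap.congr_fun h0 y)
  have := finite_hom k (R := R) (X := P l) (Z := L ⧸ N)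
  rw [Finset.sum_eq_single l] at h5
  · refine (mul_eq_zero.1 h5).resolve_right fun h0 => hπ ?_
    have h0' : Module.finrank k (P l →ₗ[R] L ⧸ N) = 0 := by exact_mod_cast h0
    rw [Module.finrank_zero_iff] at h0'
    exact Subsingleton.elim _ _
  · intro j _ hjl
    have : Subsingleton (P j →ₗ[R] L ⧸ N) := ⟨fun a b => by
      have he : IsEmpty (P l ≃ₗ[R] P j) := ⟨fun e => hjl (hP.eq_of_equiv _ _ ⟨e⟩).symm⟩
      rw [eq_zero_of_isSimpleModule (hP.indecomposable l) (hP.indecomposable j) hπ he a,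
        eq_zero_of_isSimpleModule (hP.indecomposable l) (hP.indecomposable j) hπ he b]⟩
    rw [homDim, Module.finrank_zero_of_subsingleton, Nat.cast_zero, mul_zero]
  · exact fun h => absurd hl h

end ProjectiveSystems

/-! ### Comparing and counting indecomposable summands. -/

section Summands

variable {R : Type*} [Ring R] {M M' X : Type*} [AddCommGroup M] [Module R M] [AddCommGroup M']
  [Module R M'] [AddCommGroup X] [Module R X]

theorem exists_indecSummand (hX : IsIndecomposable R X) (h : IsRetract R X M) :
    ∃ V : IndecSummand R M, Nonempty (X ≃ₗ[R] V.1) := by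
  obtain ⟨i, r, h⟩ := h
  obtain ⟨⟨e⟩, hc⟩ := exists_isCompl_of_split h
  exact ⟨⟨LinearMap.range i, hX.of_equiv e, _, hc⟩, ⟨e⟩⟩

theorem IndecSummand.isRetract (V : IndecSummand R M) : IsRetract R V.1 M := by
  obtain ⟨W, hW⟩ := V.2.2
  exact .of_isCompl hW

theorem exists_quotient_equiv (hX : IsIndecomposable R X) (h : IsRetract R X M) :
    ∃ q : Quotient (indecSummandSetoid R M), Nonempty (X ≃ₗ[R] q.out.1) := by
  obtain ⟨V, ⟨e⟩⟩ := exists_indecSummand hX h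
  obtain ⟨e'⟩ := Quotient.mk_out (s := indecSummandSetoid R M) V
  exact ⟨Quotient.mk _ V, ⟨e.trans e'.symm⟩⟩

theorem quotient_eq_of_equiv {q q' : Quotient (indecSummandSetoid R M)}
    (h : Nonempty (q.out.1 ≃ₗ[R] q'.out.1)) : q = q' := by
  rw [← q.out_eq, ← q'.out_eq]
  exact Quotient.sound h

theorem le_numSummands {ι : Type*} {T : ι → Type*} [∀ i, AddCommGroup (T i)]
    [∀ i, Module R (T i)] (hT : ∀ i, IsIndecomposable R (T i))
    (hne : ∀ i j, Nonempty (T i ≃ₗ[R] T j) → i = j) (hr : ∀ i, IsRetract R (T i) M) :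
    ∃ f : ι → Quotient (indecSummandSetoid R M), Function.Injective f ∧
      ∀ i, Nonempty (T i ≃ₗ[R] (f i).out.1) := by
  choose f hf using fun i => exists_quotient_equiv (hT i) (hr i)
  refine ⟨f, fun i j hij => hne i j ?_, hf⟩
  obtain ⟨e⟩ := hf i
  obtain ⟨e'⟩ := hf j
  rw [hij] at e
  exact ⟨e.trans e'.symm⟩

/-- If a module containing `M` as a direct summand has no more indecomposable direct summands than
`M`, then its indecomposable direct summands are direct summands of `M`. -/
theorem isRetract_of_numSummands_le (hM : IsRetract R M M')
    (hfin : numSummands R M ≠ ⊤) (h : numSummands R M' ≤ numSummands R M)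
    (hX : IsIndecomposable R X) (hr : IsRetract R X M') : IsRetract R X M := by
  obtain ⟨f, hf, hfe⟩ := le_numSummands (M := M') (T := fun q : Quotient (indecSummandSetoid R M) =>
    q.out.1) (fun q => q.out.2.1) (fun _ _ => quotient_eq_of_equiv)
    (fun q => q.out.isRetract.trans hM)
  have h1 : Finite (Quotient (indecSummandSetoid R M)) := by
    rwa [numSummands, ← lt_top_iff_ne_top, ENat.card_lt_top] at hfin
  have h2 : Finite (Quotient (indecSummandSetoid R M')) := by
    rw [← ENat.card_lt_top]
    exact h.trans_lt (lt_top_iff_ne_top.2 hfin)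
  have hle : Nat.card (Quotient (indecSummandSetoid R M')) ≤
      Nat.card (Quotient (indecSummandSetoid R M)) := by
    rwa [numSummands, numSummands, ENat.card_eq_coe_natCard, ENat.card_eq_coe_natCard,
      Nat.cast_le] at h
  -- The summands of `M` inject into those of `M'`; finiteness and the cardinality bound make this
  -- injection onto.
  have hb := hf.bijective_of_nat_card_le hle
  obtain ⟨q, ⟨e⟩⟩ := exists_quotient_equiv hX hr
  obtain ⟨q', rfl⟩ := hb.2 q
  obtain ⟨e'⟩ := hfe q'
  exact (IsRetract.of_equiv (e.trans e'.symm)).trans q'.out.isRetract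

theorem isBasicModule_pi {ι : Type*} [Finite ι] {T : ι → Type*} [∀ i, AddCommGroup (T i)]
    [∀ i, Module R (T i)] (hT : ∀ i, IsIndecomposable R (T i))
    (hne : ∀ i j, Nonempty (T i ≃ₗ[R] T j) → i = j) : IsBasicModule R (Π i, T i) := by
  classical
  cases nonempty_fintype ι
  let e := Fintype.equivFin ι
  let N : ι → Submodule R (Π i, T i) := fun i => LinearMap.range (LinearMap.single R T i)
  have eN : ∀ i, Nonempty (T i ≃ₗ[R] N i) := fun i =>
    ⟨LinearEquiv.ofInjective (LinearMap.single R T i) (Pi.single_injective i)⟩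
  refine ⟨Fintype.card ι, fun j => N (e.symm j), ?_, fun j => ?_, fun i j hij => ?_⟩
  · rw [DirectSum.isInternal_submodule_iff_iSupIndep_and_iSup_eq_top]
    constructor
    · have : iSupIndep N := fun i => by
        have := LinearMap.disjoint_single_single R T {i} {i}ᶜ disjoint_compl_right
        simpa using this
      exact this.comp e.symm.injective
    · rw [e.symm.iSup_comp (g := N)]
      exact LinearMap.iSup_range_single R T
  · obtain ⟨e'⟩ := eN (e.symm j)
    exact (hT _).of_equiv e'
  · obtain ⟨f⟩ := hij
    obtain ⟨e1⟩ := eN (e.symm i)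
    obtain ⟨e2⟩ := eN (e.symm j)
    exact e.symm.injective (hne _ _ ⟨(e1.trans f).trans e2.symm⟩)

end Summands

/-! ### The Bongartz construction by presentations. -/

section Bongartz

variable {R : Type*} [Ring R] {P₁ P₀ U Q Z : Type*} [AddCommGroup P₁] [Module R P₁]
  [AddCommGroup P₀] [Module R P₀] [AddCommGroup U] [Module R U] [AddCommGroup Q] [Module R Q]
  [AddCommGroup Z] [Module R Z]

theorem IsSuperfluous.map {R : Type v} [Ring R] {P : Type w} [AddCommGroup P] [Module R P]
    {Q : Type*} [AddCommGroup Q] [Module R Q] {K : Submodule R P} (hK : IsSuperfluous K)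
    (f : P →ₗ[R] Q) : IsSuperfluous (K.map f) := by
  intro N hN
  have h1 : N.comap f ⊔ K = ⊤ := by
    refine eq_top_iff.2 fun x _ => ?_
    obtain ⟨y, hy, _, ⟨z, hz, rfl⟩, h⟩ := Submodule.mem_sup.1 (hN ▸ Submodule.mem_top (x := f x))
    refine Submodule.mem_sup.2 ⟨x - z, ?_, z, hz, by abel⟩
    rw [Submodule.mem_comap, map_sub, ← h, add_sub_cancel_right]
    exact hy
  have h2 : K.map f ≤ N := by
    rw [Submodule.map_le_iff_le_comap, hK _ h1]
    exact le_top
  rwa [sup_eq_left.2 h2] at hN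

theorem IsSuperfluous.finset_sup {R : Type v} [Ring R] {P : Type w} [AddCommGroup P] [Module R P]
    {ι : Type*} (s : Finset ι) {K : ι → Submodule R P} (h : ∀ i ∈ s, IsSuperfluous (K i)) :
    IsSuperfluous (s.sup K) := by
  classical
  induction s using Finset.induction_on with
  | empty => exact fun N hN => by simpa using hN
  | insert i s hi ih =>
    intro N hN
    rw [Finset.sup_insert, ← sup_assoc] at hN
    exact h i (Finset.mem_insert_self i s) N
      (ih (fun j hj => h j (Finset.mem_insert_of_mem hj)) _ hN)

/-- The homomorphism `(d, φ) : P₁ᵐ → P₀ᵐ × Q`. -/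
def bongartzMap {m : ℕ} (d : P₁ →ₗ[R] P₀) (φ : (Fin m → P₁) →ₗ[R] Q) :
    (Fin m → P₁) →ₗ[R] (Fin m → P₀) × Q :=
  (LinearMap.piMap fun _ => d).prod φ

/-- The cokernel of `(d, φ) : P₁ᵐ → P₀ᵐ × Q`. -/
abbrev BongartzModule {m : ℕ} (d : P₁ →ₗ[R] P₀) (φ : (Fin m → P₁) →ₗ[R] Q) : Type _ :=
  ((Fin m → P₀) × Q) ⧸ LinearMap.range (bongartzMap d φ)

/-- Every homomorphism `P₁ → Q` factors through `φ : P₁ᵐ → Q` by a homomorphism `P₁ → P₁ᵐ` which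
extends to a homomorphism of presentations. -/
def IsApproximation {m : ℕ} (d : P₁ →ₗ[R] P₀) (φ : (Fin m → P₁) →ₗ[R] Q) : Prop :=
  ∀ b : P₁ →ₗ[R] Q, ∃ (u₁ : P₁ →ₗ[R] Fin m → P₁) (u₀ : P₀ →ₗ[R] Fin m → P₀),
    (LinearMap.piMap fun _ => d) ∘ₗ u₁ = u₀ ∘ₗ d ∧ φ ∘ₗ u₁ = b

theorem exists_isApproximation (k : Type*) [Field k] [Algebra k R] [Module.Finite R P₁]
    [Module k P₁] [IsScalarTower k R P₁] [Module k P₀] [IsScalarTower k R P₀]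
    [Module k Q] [IsScalarTower k R Q] [Module.Finite k Q] (d : P₁ →ₗ[R] P₀) :
    ∃ (m : ℕ) (φ : (Fin m → P₁) →ₗ[R] Q), IsApproximation d φ := by
  have := finite_hom k (R := R) (X := P₁) (Z := Q)
  -- `φ` collects a k-basis of Hom(P₁, Q), and `u₁`, `u₀` have the coordinates of `b` as scalar
  -- components. Scalars commute with `d`, which gives the required compatibility.
  let B := Module.finBasis k (P₁ →ₗ[R] Q)
  refine ⟨_, LinearMap.lsum R (fun _ => P₁) ℕ B, fun b => ?_⟩
  refine ⟨LinearMap.pi fun i => B.repr b i • LinearMap.id,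
    LinearMap.pi fun i => B.repr b i • LinearMap.id, ?_, ?_⟩
  · ext x i
    exact d.map_smul_of_tower (B.repr b i) x
  · ext x
    have := LinearMap.congr_fun (B.sum_repr b) x
    rw [LinearMap.sum_apply] at this
    rw [← this]
    simp [LinearMap.lsum_apply]

variable {m : ℕ} {d : P₁ →ₗ[R] P₀} {φ : (Fin m → P₁) →ₗ[R] Q} {p : P₀ →ₗ[R] U}

/-- Extending along the first component d^m suffices; the extension is taken to be zero on `Q`. -/
theorem isExtensible_bongartzMap (h : IsExtensible d Z) : IsExtensible (bongartzMap d φ) Z := by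
  intro a
  obtain ⟨b, hb⟩ := IsExtensible.pi_left (fun _ : Fin m => h) a
  refine ⟨b.coprod 0, ?_⟩
  rw [bongartzMap, LinearMap.coprod_comp_prod, hb, LinearMap.zero_comp, add_zero]

theorem exact_bongartzMap :
    Function.Exact (bongartzMap d φ) (LinearMap.range (bongartzMap d φ)).mkQ :=
  LinearMap.exact_map_mkQ_range _

/-- Lift a map from P₁ to P₀ᵐ × Q. Rigidity of `U` makes its first component factor through `d` up
to a map with values in the image of d^m. The cokernel relation moves this error into `Q`, and maps
P₁ → Q factor through `d` in the cokernel because `φ` is an approximation. -/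
theorem isExtensible_bongartzModule [Module.Projective R P₁] [Module.Projective R P₀]
    (hp : Function.Surjective p) (hdp : Function.Exact d p) (hU : IsExtensible d U)
    (hφ : IsApproximation d φ) : IsExtensible d (BongartzModule d φ) := by
  set π := (LinearMap.range (bongartzMap d φ)).mkQ with hπ
  let D : (Fin m → P₁) →ₗ[R] Fin m → P₀ := LinearMap.piMap fun _ => d
  let p' : (Fin m → P₀) →ₗ[R] Fin m → U := LinearMap.piMap fun _ => p
  have hp' : Function.Surjective p' := Function.Surjective.piMap fun _ => hp
  have hDp : Function.Exact D p' := exact_piMap fun _ => hdp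
  have hrel : ∀ y, π (D y, 0) = - π (0, φ y) := fun y => by
    rw [eq_neg_iff_add_eq_zero, ← map_add, Prod.mk_add_mk, add_zero, zero_add]
    exact (Submodule.Quotient.mk_eq_zero _).2 ⟨y, rfl⟩
  have key : ∀ b : P₁ →ₗ[R] Q, ∃ w : P₀ →ₗ[R] Fin m → P₀, ∀ x, π (0, b x) = π (w (d x), 0) := by
    intro b
    obtain ⟨u₁, u₀, hu, rfl⟩ := hφ b
    refine ⟨-u₀, fun x => ?_⟩
    have h1 : D (u₁ x) = u₀ (d x) := LinearMap.congr_fun hu x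
    rw [LinearMap.neg_apply, ← h1, LinearMap.comp_apply, ← neg_eq_iff_eq_neg.2 (hrel (u₁ x)),
      ← map_neg, Prod.neg_mk, neg_zero]
  intro a
  obtain ⟨a', rfl⟩ := Module.projective_lifting_property π a (Submodule.mkQ_surjective _)
  obtain ⟨β, hβ⟩ := IsExtensible.pi_right (fun _ : Fin m => hU)
    (p' ∘ₗ LinearMap.fst R _ _ ∘ₗ a')
  obtain ⟨β', hβ'⟩ := Module.projective_lifting_property p' β hp'
  obtain ⟨v, hv⟩ := exists_lift_of_exact hDp (LinearMap.fst R _ _ ∘ₗ a' - β' ∘ₗ d) (by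
    rw [LinearMap.comp_sub, ← LinearMap.comp_assoc, ← LinearMap.comp_assoc, hβ',
      LinearMap.comp_assoc, hβ, sub_self])
  obtain ⟨w, hw⟩ := key (LinearMap.snd R _ _ ∘ₗ a')
  obtain ⟨w', hw'⟩ := key (φ ∘ₗ v)
  refine ⟨π ∘ₗ LinearMap.inl R _ _ ∘ₗ (β' + w - w'), ?_⟩
  ext x
  have h1 : (a' x).1 = D (v x) + β' (d x) := by
    have : D (v x) = (a' x).1 - β' (d x) := LinearMap.congr_fun hv x
    rw [this, sub_add_cancel]
  have h2 : a' x = (D (v x), 0) + (β' (d x), 0) + (0, (a' x).2) := by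
    ext1
    · simp [h1]
    · simp
  have h3 := hw x
  have h4 := hw' x
  simp only [LinearMap.comp_apply, LinearMap.snd_apply] at h3 h4
  change π ((β' + w - w') (d x), 0) = π (a' x)
  rw [h2, map_add, map_add, h3, hrel, h4, ← map_neg, ← map_add, ← map_add]
  congr 1
  ext1
  · simp only [LinearMap.sub_apply, LinearMap.add_apply, Prod.fst_add, Prod.fst_neg]
    abel
  · simp

/-- If `Q` dies in the cokernel, then `Q` is the sum of the images of finitely many copies of `ker
d`. These images are superfluous, hence so is their sum, and a superfluous whole module is zero. -/
theorem subsingleton_of_mkQ_inr_eq_zero {R : Type v} [Ring R] {P₁ P₀ Q : Type w}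
    [AddCommGroup P₁] [Module R P₁] [AddCommGroup P₀] [Module R P₀] [AddCommGroup Q] [Module R Q]
    {m : ℕ} {d : P₁ →ₗ[R] P₀} {φ : (Fin m → P₁) →ₗ[R] Q} (hd : IsSuperfluous (LinearMap.ker d))
    (h : (LinearMap.range (bongartzMap d φ)).mkQ ∘ₗ LinearMap.inr R _ _ = 0) :
    Subsingleton Q := by
  classical
  have h1 : IsSuperfluous (Finset.univ.sup fun i : Fin m =>
      (LinearMap.ker d).map (φ ∘ₗ LinearMap.single R (fun _ => P₁) i)) :=
    IsSuperfluous.finset_sup _ fun i _ => hd.map _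
  have h2 : (⊥ : Submodule R Q) = ⊤ := by
    refine h1 ⊥ (eq_top_iff.2 fun x _ => ?_)
    rw [bot_sup_eq]
    obtain ⟨y, hy⟩ := (Submodule.Quotient.mk_eq_zero _).1 (LinearMap.congr_fun h x)
    have hy1 : ∀ i, d (y i) = 0 := fun i => congrFun (congrArg Prod.fst hy) i
    have hy2 : φ y = x := congrArg Prod.snd hy
    rw [← hy2, ← Finset.univ_sum_single y, map_sum]
    refine Submodule.sum_mem _ fun i hi => ?_
    exact (Finset.le_sup (f := fun i : Fin m => (LinearMap.ker d).map
      (φ ∘ₗ LinearMap.single R (fun _ => P₁) i)) hi) ⟨y i, hy1 i, rfl⟩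
  exact Submodule.subsingleton_iff R |>.1 (subsingleton_of_bot_eq_top h2)

end Bongartz

/-! ### Completion of a rigid module to one with n summands. -/

section Completion

/-- The `k`-vector space structure of a module over a `k`-algebra. -/
abbrev scalarModule (k R M : Type*) [Field k] [Ring R] [Algebra k R] [AddCommGroup M]
    [Module R M] : Module k M := Module.compHom M (algebraMap k R)

theorem isScalarTower_scalarModule (k R M : Type*) [Field k] [Ring R] [Algebra k R]
    [AddCommGroup M] [Module R M] :
    letI := scalarModule k R M
    IsScalarTower k R M := by
  let := scalarModule k R M
  exact ⟨fun c r x => by rw [Algebra.smul_def, mul_smul]; rfl⟩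

theorem projective_pi {R : Type*} [Ring R] {ι : Type*} [Finite ι] (A : ι → Type*)
    [∀ i, AddCommGroup (A i)] [∀ i, Module R (A i)] [∀ i, Module.Projective R (A i)] :
    Module.Projective R (Π i, A i) := by
  classical
  cases nonempty_fintype ι
  exact Module.Projective.of_equiv (DFinsupp.linearEquivFunOnFintype (R := R) (M := A))

/-- The direct sum of `d` and the maps `bongartzMap d (φ i)` presents the product. It is extensible
to whatever `d` is extensible to, and `d` is extensible to each factor. -/
theorem isRigid_prod_bongartzModule {R : Type v} [Ring R] [IsArtinianRing R] {P₁ P₀ U : Type v}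
    [AddCommGroup P₁] [Module R P₁] [AddCommGroup P₀] [Module R P₀] [AddCommGroup U] [Module R U]
    [Module.Finite R U] [Module.Finite R P₀]
    [Module.Projective R P₁] [Module.Projective R P₀]
    {d : P₁ →ₗ[R] P₀} {p : P₀ →ₗ[R] U} (hp : Function.Surjective p) (hdp : Function.Exact d p)
    (hU : IsExtensible d U) {ι : Type} [Finite ι] {Q : ι → Type v} [∀ i, AddCommGroup (Q i)]
    [∀ i, Module R (Q i)] [∀ i, Module.Finite R (Q i)] [∀ i, Module.Projective R (Q i)]
    {m : ι → ℕ} {φ : ∀ i, (Fin (m i) → P₁) →ₗ[R] Q i} (hφ : ∀ i, IsApproximation d (φ i)) :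
    IsRigid R (U × Π i, BongartzModule d (φ i)) := by
  obtain ⟨π⟩ := exists_minimalPresentation R (U × Π i, BongartzModule d (φ i))
  have := fun i => projective_pi (R := R) fun _ : Fin (m i) => P₁
  have := fun i => projective_pi (R := R) fun _ : Fin (m i) => P₀
  have := projective_pi (R := R) fun i => Fin (m i) → P₁
  have := projective_pi (R := R) fun i => (Fin (m i) → P₀) × Q i
  have hd : IsExtensible d (U × Π i, BongartzModule d (φ i)) :=
    hU.prod_right (IsExtensible.pi_right fun i => isExtensible_bongartzModule hp hdp hU (hφ i))
  refine ⟨π, π.isExtensible (d' := d.prodMap (LinearMap.piMap fun i => bongartzMap d (φ i)))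
    (p' := p.prodMap (LinearMap.piMap fun i => (LinearMap.range (bongartzMap d (φ i))).mkQ))
    ?_ ?_ .refl ?_⟩
  · exact hp.prodMap (Function.Surjective.piMap fun i => Submodule.mkQ_surjective _)
  · have := exact_piMap fun i => exact_bongartzMap (d := d) (φ := φ i)
    rintro ⟨x, y⟩
    constructor
    · intro h
      obtain ⟨x', hx'⟩ := (hdp x).1 (congrArg Prod.fst h)
      obtain ⟨y', hy'⟩ := (this y).1 (congrArg Prod.snd h)
      exact ⟨(x', y'), Prod.ext hx' hy'⟩
    · rintro ⟨⟨x', y'⟩, h⟩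
      exact Prod.ext ((hdp x).2 ⟨x', congrArg Prod.fst h⟩) ((this y).2 ⟨y', congrArg Prod.snd h⟩)
  · exact hd.prodMap (IsExtensible.pi_left fun i => isExtensible_bongartzMap hd)

variable (k : Type u) [Field k] {R : Type v} [Ring R] [Algebra k R]
  [IsArtinianRing R] {n : ℕ} {P : Fin n → Type v} [∀ j, AddCommGroup (P j)] [∀ j, Module R (P j)]

omit [IsArtinianRing R] in
-- The presentation of the cokernel gives mP₀ + Q − mP₁ on the level of functions, and P₀ − P₁ is
-- the function of `U`.
theorem homFun_bongartzModule {M : Type*} [AddCommGroup M] [Module R M] [Module k M]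
    [IsScalarTower k R M] [Module.Finite k M] {P₁ P₀ U Q : Type*}
    [AddCommGroup P₁] [Module R P₁] [AddCommGroup P₀] [Module R P₀] [AddCommGroup U] [Module R U]
    [AddCommGroup Q] [Module R Q] [Module.Finite R P₁] [Module.Finite R P₀] [Module.Finite R Q]
    [Module.Projective R P₁]
    {d : P₁ →ₗ[R] P₀} {p : P₀ →ₗ[R] U} (hp : Function.Surjective p) (hdp : Function.Exact d p)
    (hd : IsExtensible d M) {m : ℕ} (φ : (Fin m → P₁) →ₗ[R] Q) :
    homFun k R M (BongartzModule d φ) = (m : ℚ) • homFun k R M U + homFun k R M Q := by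
  have h1 := homFun_of_isExtensible k hp hdp hd
  have := projective_pi (R := R) fun _ : Fin m => P₁
  have h2 := homFun_of_isExtensible k (Submodule.mkQ_surjective _)
    (exact_bongartzMap (d := d) (φ := φ)) (isExtensible_bongartzMap hd)
  funext I
  have := finite_quotientIndex k I
  have e1 := congrFun h1 I
  have e2 := congrFun h2 I
  simp only [homFun, Pi.add_apply, Pi.smul_apply, smul_eq_mul] at e1 e2 ⊢
  rw [homDim_prod, homDim_pi, homDim_pi] at e2
  push_cast at e2
  rw [e1] at e2
  linear_combination -e2

/-- A basic module with the same indecomposable direct summands as `M`. -/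
theorem exists_isBasicModule {M : Type v} [AddCommGroup M] [Module R M] [Module.Finite R M]
    (hM : IsRigid R M) (hfin : numSummands R M ≠ ⊤) :
    ∃ (B : Type v) (_ : AddCommGroup B) (_ : Module R B), Module.Finite R B ∧ IsBasicModule R B ∧
      IsRigid R B ∧ numSummands R M ≤ numSummands R B ∧
      ∀ (X : Type v) [AddCommGroup X] [Module R X], IsIndecomposable R X → IsRetract R X M →
        IsRetract R X B := by
  let ι := Quotient (indecSummandSetoid R M)
  have : Finite ι := by rwa [numSummands, ← lt_top_iff_ne_top, ENat.card_lt_top] at hfin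
  cases nonempty_fintype ι
  let T : ι → Submodule R M := fun q => q.out.1
  have hT : ∀ q, IsIndecomposable R (T q) := fun q => q.out.2.1
  have hne : ∀ i j, Nonempty (T i ≃ₗ[R] T j) → i = j := fun _ _ => quotient_eq_of_equiv
  have hret : ∀ q, IsRetract R (T q) M := fun q => q.out.isRetract
  have hfinT : ∀ q, Module.Finite R (T q) := fun q => (hret q).finite
  refine ⟨Π q, T q, inferInstance, inferInstance, inferInstance, isBasicModule_pi hT hne, ?_, ?_,
    ?_⟩
  · obtain ⟨ρ, hρ⟩ := hM
    obtain ⟨π⟩ := exists_minimalPresentation R (Π q, T q)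
    have := projective_pi (R := R) fun _ : ι => ρ.P₁
    have := projective_pi (R := R) fun _ : ι => ρ.P₀
    refine ⟨π, π.isExtensible (d' := LinearMap.piMap fun _ : ι => ρ.d)
      (p' := LinearMap.piMap fun _ : ι => ρ.p)
      (Function.Surjective.piMap fun _ => ρ.surjective) (exact_piMap fun _ => ρ.exact)
      (.pi hret) (IsExtensible.pi_left fun _ => ?_)⟩
    exact IsExtensible.pi_right fun q => hρ.of_isRetract_right (hret q)
  · obtain ⟨f, hf, -⟩ := le_numSummands (M := Π q, T q) hT hne (.pi_apply (fun q => T q))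
    exact ENat.card_le_card_of_injective hf
  · intro X _ _ hX hXM
    obtain ⟨q, ⟨e⟩⟩ := exists_quotient_equiv hX hXM
    exact (IsRetract.of_equiv e).trans (.pi_apply (fun q => T q) q)

/-- An indecomposable rigid module is a direct summand of a basic rigid module with the maximal
number of summands. -/
theorem IsProjectiveSystem.exists_completion (k : Type u) [Field k] [Algebra k R]
    [FiniteDimensional k R] (hP : IsProjectiveSystem R P) {P₁ P₀ U : Type v}
    [AddCommGroup P₁] [Module R P₁] [AddCommGroup P₀] [Module R P₀] [AddCommGroup U] [Module R U]
    [Module.Finite R P₁] [Module.Finite R P₀] [Module.Projective R P₁] [Module.Projective R P₀]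
    {d : P₁ →ₗ[R] P₀} {p : P₀ →ₗ[R] U} (hp : Function.Surjective p) (hdp : Function.Exact d p)
    (hd : IsSuperfluous (LinearMap.ker d)) (hU : IsExtensible d U) (hUi : IsIndecomposable R U) :
    ∃ (M : Type v) (_ : AddCommGroup M) (_ : Module R M), Module.Finite R M ∧
      IsBasicModule R M ∧ IsRigid R M ∧ numSummands R M = n ∧ IsRetract R U M := by
  have hPf := hP.finite
  have hPp := hP.projective
  have hUf : Module.Finite R U := Module.Finite.of_surjective p hp
  let := scalarModule k R P₁
  let := scalarModule k R P₀
  let := fun j => scalarModule k R (P j)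
  have := isScalarTower_scalarModule k R P₁
  have := isScalarTower_scalarModule k R P₀
  have := fun j => isScalarTower_scalarModule k R (P j)
  have := fun j => Module.Finite.trans (R := k) R (P j)
  choose m φ hφ using fun j => exists_isApproximation k (Q := P j) d
  let N := U × Π j, BongartzModule d (φ j)
  have hN : IsRigid R N := isRigid_prod_bongartzModule hp hdp hU hφ
  have hNd : IsExtensible d N :=
    hU.prod_right (IsExtensible.pi_right fun j => isExtensible_bongartzModule hp hdp hU (hφ j))
  let := scalarModule k R N
  have := isScalarTower_scalarModule k R N
  have hNf : Module.Finite R N := inferInstance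
  have := Module.Finite.trans (R := k) R N
  have hle := hP.numSummands_le k N hN
  have hfin : numSummands R N ≠ ⊤ := ne_top_of_le_ne_top (ENat.natCast_ne_top n) hle
  -- Sincerity of `N` is what makes the functions of the projectives independent. The canonical map
  -- of `P j` into its Bongartz module is nonzero because `ker d` is superfluous.
  have hsinc : ∀ j, ∃ f : P j →ₗ[R] N, f ≠ 0 := fun j => by
    refine ⟨LinearMap.inr R _ _ ∘ₗ LinearMap.single R _ j ∘ₗ
      (LinearMap.range (bongartzMap d (φ j))).mkQ ∘ₗ LinearMap.inr R _ _, fun h0 => ?_⟩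
    have := (hP.indecomposable j).1
    refine not_subsingleton (P j) (subsingleton_of_mkQ_inr_eq_zero (φ := φ j) hd ?_)
    ext x
    have h1 := congrFun (congrArg Prod.snd (LinearMap.congr_fun h0 x)) j
    change Pi.single (M := fun j => BongartzModule d (φ j)) j _ j = 0 at h1
    rwa [Pi.single_eq_same] at h1
  have hli := hP.linearIndependent k N hsinc
  let T : Quotient (indecSummandSetoid R N) → Submodule R N := fun q => q.out.1
  let W := Submodule.span ℚ (Set.range fun q => homFun k R N (T q))
  have hW : ∀ X : Type v, ∀ [AddCommGroup X] [Module R X], IsRetract R X N →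
      homFun k R N X ∈ W := fun X _ _ hX => by
    have := hX.finite
    refine homFun_mem_of_isIndecomposable k W fun V hV hVi => ?_
    obtain ⟨q, ⟨e⟩⟩ := exists_quotient_equiv hVi (hV.trans hX)
    rw [homFun_congr (Y := T q) k e]
    exact Submodule.subset_span ⟨q, rfl⟩
  -- The dimension formula of `homFun_bongartzModule`, solved for `P j`, expresses its function by
  -- summands of `N`.
  have hPW : Set.range (fun j => homFun k R N (P j)) ≤ W := by
    rintro _ ⟨j, rfl⟩
    have h1 := hW (BongartzModule d (φ j))
      ((IsRetract.pi_apply (fun j => BongartzModule d (φ j)) j).trans .prod_right)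
    have h2 := W.smul_mem (m j : ℚ) (hW U .prod_left)
    have h3 := W.sub_mem h1 h2
    rwa [homFun_bongartzModule k hp hdp hNd, add_sub_cancel_left] at h3
  have : Finite (Quotient (indecSummandSetoid R N)) := by
    rwa [numSummands, ← lt_top_iff_ne_top, ENat.card_lt_top] at hfin
  -- The `n` independent functions of the projectives lie in the span of the functions of the
  -- summands of `N`.
  have hge : (n : ℕ∞) ≤ numSummands R N := by
    cases nonempty_fintype (Quotient (indecSummandSetoid R N))
    have := Fintype.ofFinite (Set.range fun q => homFun k R N (T q))
    have h1 := linearIndependent_le_span_aux' _ hli _ hPW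
    rw [Fintype.card_fin] at h1
    rw [numSummands, ENat.card_eq_coe_fintype_card, Nat.cast_le]
    exact h1.trans (Fintype.card_range_le _)
  obtain ⟨B, _, _, hBf, hBb, hBr, hBn, hB⟩ := exists_isBasicModule hN hfin
  let := scalarModule k R B
  have := isScalarTower_scalarModule k R B
  have := Module.Finite.trans (R := k) R B
  exact ⟨B, _, _, hBf, hBb, hBr, le_antisymm (hP.numSummands_le k B hBr) (hge.trans hBn),
    hB U hUi .prod_left⟩

end Completion

/-! ### τ-rigidity in terms of presentations. -/

section Translate

open MulOpposite

/-- `A` as a right module over itself is the left regular module of `Aᵐᵒᵖ`. -/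
def opRegularEquiv (A : Type*) [Ring A] : A ≃ₗ[Aᵐᵒᵖ] Aᵐᵒᵖ where
  toFun := op
  invFun := unop
  left_inv _ := rfl
  right_inv _ := rfl
  map_add' _ _ := rfl
  map_smul' _ _ := rfl

instance (A : Type*) [Ring A] : Module.Finite Aᵐᵒᵖ A :=
  Module.Finite.equiv (opRegularEquiv A).symm

instance (A : Type*) [Ring A] : Module.Projective Aᵐᵒᵖ A :=
  Module.Projective.of_equiv (opRegularEquiv A).symm

variable {A : Type v} [Ring A]

/-- The dual basis lemma makes M ⊗ Hom(P, A) ≅ Hom(P, M) explicit: `smulHom m φ` stands for the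
tensor m ⊗ φ. -/
theorem exists_dualBasis (P : Type*) [AddCommGroup P] [Module Aᵐᵒᵖ P] [Module.Finite Aᵐᵒᵖ P]
    [Module.Projective Aᵐᵒᵖ P] :
    ∃ (n : ℕ) (x : Fin n → P) (ξ : Fin n → P →ₗ[Aᵐᵒᵖ] A), ∀ p, p = ∑ i, op (ξ i p) • x i := by
  obtain ⟨n, f, hf⟩ := Module.Finite.exists_fin' Aᵐᵒᵖ P
  obtain ⟨g, hg⟩ := Module.projective_lifting_property f LinearMap.id hf
  refine ⟨n, fun i => f (Pi.single i 1), fun i =>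
    (opRegularEquiv A).symm.toLinearMap ∘ₗ LinearMap.proj i ∘ₗ g, fun p => ?_⟩
  have h : p = f (g p) := (LinearMap.congr_fun hg p).symm
  conv_lhs => rw [h, pi_eq_sum_univ' (g p), map_sum]
  refine Finset.sum_congr rfl fun i _ => ?_
  rw [map_smul]
  congr 2

/-- The homomorphism `x ↦ m · φ(x)`. -/
def smulHom {P M : Type*} [AddCommGroup P] [Module Aᵐᵒᵖ P] [AddCommGroup M] [Module Aᵐᵒᵖ M]
    (m : M) (φ : P →ₗ[Aᵐᵒᵖ] A) : P →ₗ[Aᵐᵒᵖ] M :=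
  LinearMap.toSpanSingleton Aᵐᵒᵖ M m ∘ₗ (opRegularEquiv A).toLinearMap ∘ₗ φ

theorem smulHom_apply {P M : Type*} [AddCommGroup P] [Module Aᵐᵒᵖ P] [AddCommGroup M]
    [Module Aᵐᵒᵖ M] (m : M) (φ : P →ₗ[Aᵐᵒᵖ] A) (x : P) : smulHom m φ x = op (φ x) • m := rfl

theorem eq_sum_smul_of_dualBasis {P : Type*} [AddCommGroup P] [Module Aᵐᵒᵖ P] {n : ℕ}
    {x : Fin n → P} {ξ : Fin n → P →ₗ[Aᵐᵒᵖ] A} (h : ∀ p, p = ∑ i, op (ξ i p) • x i)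
    (φ : P →ₗ[Aᵐᵒᵖ] A) : φ = ∑ i, φ (x i) • ξ i := by
  ext p
  conv_lhs => rw [h p, map_sum]
  simp [LinearMap.sum_apply, map_smul]

theorem eq_sum_smulHom_of_dualBasis {P M : Type*} [AddCommGroup P] [Module Aᵐᵒᵖ P]
    [AddCommGroup M] [Module Aᵐᵒᵖ M] {n : ℕ}
    {x : Fin n → P} {ξ : Fin n → P →ₗ[Aᵐᵒᵖ] A} (h : ∀ p, p = ∑ i, op (ξ i p) • x i)
    (α : P →ₗ[Aᵐᵒᵖ] M) : α = ∑ i, smulHom (α (x i)) (ξ i) := by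
  ext p
  conv_lhs => rw [h p, map_sum]
  simp [LinearMap.sum_apply, map_smul, smulHom_apply]

variable (k : Type u) [Field k] [Algebra k A]

/-- A map M → D Tr M is a balanced pairing of M with Hom(P₁, A) that vanishes on the maps factoring
through `d`. It thus corresponds to a functional on Hom(P₁, M) killing the image of Hom(P₀, M),
which is everything. -/
theorem eq_zero_of_isExtensible {M : Type w} [AddCommGroup M] [Module Aᵐᵒᵖ M]
    (π : MinimalPresentation Aᵐᵒᵖ M) (h : IsExtensible π.d M) (f : M →ₗ[Aᵐᵒᵖ] KDual k π.Tr) :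
    f = 0 := by
  let G : M → π.Tr →ₗ[k] k := fun m => f m
  let q := (LinearMap.range (homToRing π.d)).mkQ
  let v : M → (π.P₁ →ₗ[Aᵐᵒᵖ] A) → k := fun m φ => G m (q φ)
  have G_add : ∀ m m', G (m + m') = G m + G m' := fun m m' => map_add f m m'
  have G_smul : ∀ (a : A) m t, G (op a • m) t = G m (a • t) := fun a m t =>
    LinearMap.congr_fun (show G (op a • m) = _ from map_smul f (op a) m) t
  have v_sum' : ∀ {n : ℕ} (m : Fin n → M) φ, v (∑ i, m i) φ = ∑ i, v (m i) φ := fun m φ =>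
    map_sum (AddMonoidHom.mk' (fun m => v m φ) fun m m' => by
      simp only [v, G_add, LinearMap.add_apply]) m _
  have v_sum : ∀ {n : ℕ} m (φ : Fin n → _), v m (∑ i, φ i) = ∑ i, v m (φ i) := fun m φ => by
    simp only [v]
    rw [map_sum, map_sum]
  have v_smul : ∀ (a : A) m φ, v (op a • m) φ = v m (a • φ) := fun a m φ => by
    simp only [v, G_smul]
    rw [q.map_smul]
  have v_comp : ∀ m (ψ : π.P₀ →ₗ[Aᵐᵒᵖ] A), v m (ψ ∘ₗ π.d) = 0 := fun m ψ => by
    have : q (ψ ∘ₗ π.d) = 0 := (Submodule.Quotient.mk_eq_zero _).2 ⟨ψ, rfl⟩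
    simp only [v]
    rw [this, map_zero]
  obtain ⟨n, x, ξ, hx⟩ := exists_dualBasis (A := A) π.P₁
  obtain ⟨m, y, η, hy⟩ := exists_dualBasis (A := A) π.P₀
  -- With `smulHom z φ = b ∘ d`, expansion in both dual bases writes `v z φ` as the sum of the
  -- values of `v (b (y j))` at `η j ∘ d`, which vanish.
  have key : ∀ z φ, v z φ = 0 := fun z φ => by
    obtain ⟨b, hb⟩ := h (smulHom z φ)
    have h1 : ∀ i, op (φ (x i)) • z = ∑ j, op (η j (π.d (x i))) • b (y j) := fun i => by
      rw [← smulHom_apply, ← hb, LinearMap.comp_apply]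
      conv_lhs => rw [hy (π.d (x i)), map_sum]
      simp only [map_smul]
    rw [eq_sum_smul_of_dualBasis hx φ, v_sum]
    simp only [← v_smul, h1, v_sum']
    rw [Finset.sum_comm]
    refine Finset.sum_eq_zero fun j _ => ?_
    simp only [v_smul]
    rw [← v_sum]
    have h2 := eq_sum_smul_of_dualBasis hx (η j ∘ₗ π.d)
    simp only [LinearMap.comp_apply] at h2
    rw [← h2, v_comp]
  ext z
  refine LinearMap.ext fun t => ?_
  obtain ⟨φ, rfl⟩ := Submodule.mkQ_surjective _ t
  exact key z φ

/-- If some `a` did not factor through `d`, a functional F on Hom(P₁, M) would vanish on the maps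
that do, but not at `a`. Then m ↦ (φ ↦ F(m · φ)) would be a nonzero map M → D Tr M, because the maps
m · φ span Hom(P₁, M). -/
theorem isExtensible_of_forall_eq_zero {M : Type w} [AddCommGroup M] [Module Aᵐᵒᵖ M]
    (π : MinimalPresentation Aᵐᵒᵖ M) (h : ∀ f : M →ₗ[Aᵐᵒᵖ] KDual k π.Tr, f = 0) :
    IsExtensible π.d M := by
  let := scalarModule k Aᵐᵒᵖ M
  have := isScalarTower_scalarModule k Aᵐᵒᵖ M
  intro a
  by_contra ha
  have ha' : a ∉ LinearMap.range (precomp k π.d M) := ha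
  obtain ⟨F, hFa, hF⟩ := Submodule.exists_le_ker_of_notMem ha'
  let g : M → (π.P₁ →ₗ[Aᵐᵒᵖ] A) →ₗ[k] k := fun m => F ∘ₗ
    { toFun := fun φ => smulHom m φ
      map_add' := fun φ ψ => by
        ext x
        simp [smulHom_apply, add_smul]
      map_smul' := fun c φ => by
        ext x
        simp [smulHom_apply] }
  have hg : ∀ m, (LinearMap.range (homToRing π.d)).restrictScalars k ≤ LinearMap.ker (g m) := by
    rintro m _ ⟨ψ, rfl⟩
    exact hF ⟨smulHom m ψ, rfl⟩
  let f : M →ₗ[Aᵐᵒᵖ] KDual k π.Tr :=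
    { toFun := fun m => ((LinearMap.range (homToRing π.d)).restrictScalars k).liftQ (g m) (hg m) ∘ₗ
        (Submodule.Quotient.restrictScalarsEquiv k
          (LinearMap.range (homToRing π.d))).symm.toLinearMap
      map_add' := fun m m' => LinearMap.ext fun t => by
        obtain ⟨φ, rfl⟩ := Submodule.mkQ_surjective _ t
        change F (smulHom (m + m') φ) = F (smulHom m φ) + F (smulHom m' φ)
        rw [← map_add]
        congr 1
        ext x
        simp [smulHom_apply]
      map_smul' := fun a m => LinearMap.ext fun t => by
        obtain ⟨φ, rfl⟩ := Submodule.mkQ_surjective _ t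
        change F (smulHom (a • m) φ) = F (smulHom m (a.unop • φ))
        congr 1
        ext x
        simp [smulHom_apply, mul_smul] }
  have hf : ∀ m φ, F (smulHom m φ) = 0 := fun m φ =>
    LinearMap.congr_fun (show (f m : π.Tr →ₗ[k] k) = 0 by rw [h f]; rfl)
      ((LinearMap.range (homToRing π.d)).mkQ φ)
  obtain ⟨n, x, ξ, hx⟩ := exists_dualBasis (A := A) π.P₁
  apply hFa
  rw [eq_sum_smulHom_of_dualBasis hx a, map_sum]
  exact Finset.sum_eq_zero fun i _ => hf _ _

theorem isTauRigid_iff_isRigid [FiniteDimensional k A] (M : Type v) [AddCommGroup M]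
    [Module Aᵐᵒᵖ M] [Module.Finite Aᵐᵒᵖ M] : IsTauRigid k A M ↔ IsRigid Aᵐᵒᵖ M := by
  have : IsArtinianRing Aᵐᵒᵖ := isArtinian_of_tower k inferInstance
  constructor
  · exact fun h => ⟨minimalPresentation k A M, isExtensible_of_forall_eq_zero k _ h⟩
  · rintro ⟨ρ, hρ⟩ f
    exact eq_zero_of_isExtensible k _
      ((minimalPresentation k A M).isExtensible ρ.surjective ρ.exact .refl hρ) f

end Translate

/-! ### Idempotents, the size of A, and absence of loops. -/

section Idempotents

open MulOpposite

variable {A : Type v} [Ring A]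

theorem mem_span_idempotent {e : A} (he : IsIdempotentElem e) {x : A} :
    x ∈ Submodule.span Aᵐᵒᵖ {e} ↔ e * x = x := by
  rw [Submodule.mem_span_singleton]
  constructor
  · rintro ⟨a, rfl⟩
    rw [← op_unop a, op_smul_eq_mul, ← mul_assoc, he.eq]
  · intro h
    exact ⟨op x, by rw [op_smul_eq_mul, h]⟩

/-- Left multiplication by `a` as an endomorphism of the right module `A`. -/
def leftMul (a : A) : A →ₗ[Aᵐᵒᵖ] A where
  toFun x := a * x
  map_add' := mul_add a
  map_smul' r x := (mul_assoc a x r.unop).symm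

theorem leftMul_apply (a x : A) : leftMul a x = a * x := rfl

theorem isRetract_span_idempotent {e : A} (he : IsIdempotentElem e) :
    IsRetract Aᵐᵒᵖ (Submodule.span Aᵐᵒᵖ {e}) A := by
  refine ⟨Submodule.subtype _, (leftMul e).codRestrict _ fun x => ?_, ?_⟩
  · rw [mem_span_idempotent he, leftMul_apply, ← mul_assoc, he.eq]
  · ext x
    exact (mem_span_idempotent he).1 x.2

/-- Splitting `e` along a decomposition of eA gives two orthogonal idempotents whose left
multiplications are the two projections. -/
theorem IsPrimitiveIdempotent.isIndecomposable {e : A} (he : IsPrimitiveIdempotent e) :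
    IsIndecomposable Aᵐᵒᵖ (Submodule.span Aᵐᵒᵖ {e}) := by
  obtain ⟨hi, h0, h⟩ := he
  have hmem : e ∈ Submodule.span Aᵐᵒᵖ {e} := Submodule.mem_span_singleton_self e
  refine ⟨⟨⟨⟨e, hmem⟩, 0, fun h => h0 (congrArg Subtype.val h)⟩⟩, fun U V hUV => ?_⟩
  obtain ⟨u, hu, v, hv, huv⟩ := Submodule.mem_sup.1
    (hUV.sup_eq_top ▸ Submodule.mem_top (x := (⟨e, hmem⟩ : Submodule.span Aᵐᵒᵖ {e})))
  have huv' : (u : A) + v = e := congrArg Subtype.val huv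
  have hmul : ∀ x : Submodule.span Aᵐᵒᵖ {e}, (u : A) * x + v * x = x := fun x => by
    rw [← add_mul, huv', (mem_span_idempotent hi).1 x.2]
  have hU : ∀ x ∈ U, (u : A) * x = x ∧ (v : A) * x = 0 := fun x hx => by
    have h1 : op (x : A) • v ∈ U := by
      have : op (x : A) • v = x - op (x : A) • u := by
        ext
        exact eq_sub_of_add_eq' (hmul x)
      rw [this]
      exact U.sub_mem hx (U.smul_mem _ hu)
    have h2 : op (x : A) • v = 0 := Submodule.disjoint_def.1 hUV.disjoint _ h1 (V.smul_mem _ hv)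
    have h3 : (v : A) * x = 0 := congrArg Subtype.val h2
    exact ⟨by simpa [h3] using hmul x, h3⟩
  have hV : ∀ x ∈ V, (v : A) * x = x ∧ (u : A) * x = 0 := fun x hx => by
    have h1 : op (x : A) • u ∈ V := by
      have : op (x : A) • u = x - op (x : A) • v := by
        ext
        exact eq_sub_of_add_eq (hmul x)
      rw [this]
      exact V.sub_mem hx (V.smul_mem _ hv)
    have h2 : op (x : A) • u = 0 := Submodule.disjoint_def.1 hUV.disjoint _ (U.smul_mem _ hu) h1
    have h3 : (u : A) * x = 0 := congrArg Subtype.val h2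
    exact ⟨by simpa [h3] using hmul x, h3⟩
  rcases h u v (hU u hu).1 (hV v hv).1 (hV v hv).2 (hU u hu).2 huv'.symm with hz | hz
  · left
    rw [eq_bot_iff]
    intro x hx
    have := (hU x hx).1
    rw [hz, zero_mul] at this
    exact Subtype.ext this.symm
  · right
    rw [eq_bot_iff]
    intro x hx
    have := (hV x hx).1
    rw [hz, zero_mul] at this
    exact Subtype.ext this.symm

theorem IsBasicSystem.isProjectiveSystem {n : ℕ} {e : Fin n → A} (he : IsBasicSystem A e) :
    IsProjectiveSystem Aᵐᵒᵖ fun j => Submodule.span Aᵐᵒᵖ {e j} where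
  finite j := (isRetract_span_idempotent (he.2.1 j).1).finite
  projective j := (isRetract_span_idempotent (he.2.1 j).1).projective
  indecomposable j := (he.2.1 j).isIndecomposable
  eq_of_equiv := he.2.2
  isRetract := by
    refine (IsRetract.of_equiv (opRegularEquiv A).symm).trans ⟨LinearMap.pi fun j =>
      (leftMul (e j)).codRestrict _ fun x => ?_,
      ∑ j, (Submodule.subtype _) ∘ₗ LinearMap.proj j, ?_⟩
    · rw [mem_span_idempotent (he.2.1 j).1, leftMul_apply, ← mul_assoc, (he.2.1 j).1.eq]
    · ext
      simp [leftMul_apply, he.1.complete]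

theorem isRigid_regular [IsArtinianRing Aᵐᵒᵖ] : IsRigid Aᵐᵒᵖ A := by
  obtain ⟨π⟩ := exists_minimalPresentation Aᵐᵒᵖ A
  refine ⟨π, π.isExtensible (d' := (0 : PUnit →ₗ[Aᵐᵒᵖ] A)) (p' := LinearMap.id)
    Function.surjective_id ?_ .refl fun a => ⟨0, ?_⟩⟩
  · rw [LinearMap.exact_iff, LinearMap.ker_id, LinearMap.range_zero]
  · ext x
    rw [Subsingleton.elim x 0, map_zero, map_zero]

/-- The regular module is rigid, so the general bound gives the upper estimate. -/
theorem IsBasicSystem.numSummands (k : Type u) [Field k] [Algebra k A] [FiniteDimensional k A]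
    [IsArtinianRing Aᵐᵒᵖ] {n : ℕ} {e : Fin n → A} (he : IsBasicSystem A e) :
    numSummands Aᵐᵒᵖ A = n := by
  have hP := he.isProjectiveSystem
  refine le_antisymm (hP.numSummands_le k A isRigid_regular) ?_
  obtain ⟨f, hf, -⟩ := le_numSummands hP.indecomposable hP.eq_of_equiv
    fun j => isRetract_span_idempotent (he.2.1 j).1
  have h := ENat.card_le_card_of_injective hf
  rwa [ENat.card_eq_coe_fintype_card, Fintype.card_fin] at h

/-- Left multiplication by eze is an endomorphism of the indecomposable module eA. It is not a unit,
as `e` is not in the radical, so it is nilpotent. Were it nonzero, its projective image would split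
off, making the kernel a proper summand, hence zero; but a nilpotent endomorphism of a nonzero
module is not injective. -/
theorem mul_mul_eq_zero_of_projective (k : Type u) [Field k] [Algebra k A] [FiniteDimensional k A]
    [IsArtinianRing Aᵐᵒᵖ] (hA : ∀ I : Submodule Aᵐᵒᵖ A, Module.Projective Aᵐᵒᵖ I) {e : A}
    (he : IsPrimitiveIdempotent e) {z : A} (hz : z ∈ Ring.jacobson A) : e * z * e = 0 := by
  by_contra h0
  have hmem : ∀ x, e * x ∈ Submodule.span Aᵐᵒᵖ {e} := fun x => by
    rw [mem_span_idempotent he.1, ← mul_assoc, he.1.eq]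
  let f : Module.End Aᵐᵒᵖ (Submodule.span Aᵐᵒᵖ {e}) :=
    (leftMul (e * z * e) ∘ₗ Submodule.subtype _).codRestrict _ fun x => by
      rw [LinearMap.comp_apply, leftMul_apply, mul_assoc, mul_assoc]
      exact hmem _
  have hf0 : f ≠ 0 := fun h => h0 (by
    have h1 : e * z * e * e = 0 := congrArg Subtype.val
      (LinearMap.congr_fun h ⟨e, Submodule.mem_span_singleton_self e⟩)
    rwa [mul_assoc _ e e, he.1.eq] at h1)
  have hi := he.isIndecomposable
  have hfin := (isRetract_span_idempotent he.1).finite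
  rcases hi.isUnit_or_isNilpotent f with hu | ⟨m, hm⟩
  · obtain ⟨y, hy⟩ := ((Module.End.isUnit_iff f).1 hu).2
      ⟨e, Submodule.mem_span_singleton_self e⟩
    have hy' : e * z * e * y = e := congrArg Subtype.val hy
    have heJ : e ∈ Ring.jacobson A := by
      rw [← hy']
      exact Ideal.mul_mem_right _ _ (Ideal.mul_mem_right _ _ (Ideal.mul_mem_left _ _ hz))
    rw [← Ideal.jacobson_bot, Ideal.mem_jacobson_iff] at heJ
    -- The value −1 yields c(1 − e) = 1; multiplication by `e` on the right gives e = 0.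
    obtain ⟨c, hc⟩ := heJ (-1)
    rw [Ideal.mem_bot, sub_eq_zero] at hc
    have h1 := congrArg (· * e) hc
    simp only [mul_neg, mul_one, neg_mul, add_mul, one_mul, mul_assoc, he.1.eq,
      neg_add_cancel] at h1
    exact he.2.1 h1.symm
  · have hproj : Module.Projective Aᵐᵒᵖ (LinearMap.range f) := by
      have := hA ((LinearMap.range f).map (Submodule.subtype _))
      exact Module.Projective.of_equiv ((LinearMap.range f).equivMapOfInjective _
        (Submodule.injective_subtype _)).symm
    obtain ⟨s, hs⟩ := Module.projective_lifting_property f.rangeRestrict LinearMap.id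
      f.surjective_rangeRestrict
    obtain ⟨-, hc⟩ := exists_isCompl_of_split (X := LinearMap.range f) hs
    rw [LinearMap.ker_rangeRestrict] at hc
    rcases hi.2 _ _ hc with h1 | h1
    · rw [h1] at hc
      have : LinearMap.ker f = ⊤ := by simpa using hc.sup_eq_top
      exact hf0 (LinearMap.ker_eq_top.1 this)
    · have hinj : Function.Injective (f ^ m) := by
        rw [Module.End.coe_pow]
        exact (LinearMap.ker_eq_bot.1 h1).iterate m
      have := hi.1
      obtain ⟨y, hy⟩ := exists_ne (0 : Submodule.span Aᵐᵒᵖ {e})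
      exact hy (hinj (by rw [hm]; rfl))

end Idempotents

/-! ### Rigidity of simple modules at vertices without loops. -/

section SimpleModules

open MulOpposite

variable {A : Type v} [Ring A]

/-- The kernel of a nonzero homomorphism from an indecomposable projective module to a simple module
is superfluous. -/
theorem isSuperfluous_ker_of_isSimpleModule {R : Type v} [Ring R] [IsArtinianRing R] {P : Type w}
    {S : Type*} [AddCommGroup P] [Module R P] [AddCommGroup S] [Module R S] [Module.Finite R P]
    [Module.Projective R P] (hP : IsIndecomposable R P) [IsSimpleModule R S] {p : P →ₗ[R] S}
    (hp : p ≠ 0) : IsSuperfluous (LinearMap.ker p) := by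
  intro N hN
  have hs := LinearMap.surjective_of_ne_zero hp
  have hNs : Function.Surjective (p ∘ₗ N.subtype) := fun s => by
    obtain ⟨x, rfl⟩ := hs s
    obtain ⟨y, hy, z, hz, rfl⟩ := Submodule.mem_sup.1 (hN ▸ Submodule.mem_top (x := x))
    exact ⟨⟨y, hy⟩, by simp [LinearMap.mem_ker.1 hz]⟩
  obtain ⟨g, hg⟩ := Module.projective_lifting_property _ p hNs
  have e : p ∘ₗ (N.subtype ∘ₗ g) = p := by rw [← LinearMap.comp_assoc, hg]
  have e' : ∀ m : ℕ, p ∘ₗ ((N.subtype ∘ₗ g : Module.End R P) ^ m) = p := fun m => by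
    induction m with
    | zero => rfl
    | succ m ih => rw [pow_succ', Module.End.mul_eq_comp, ← LinearMap.comp_assoc, e, ih]
  rcases hP.isUnit_or_isNilpotent (N.subtype ∘ₗ g) with hu | ⟨m, hm⟩
  · refine eq_top_iff.2 fun x _ => ?_
    obtain ⟨y, rfl⟩ := ((Module.End.isUnit_iff _).1 hu).2 x
    exact (g y).2
  · exact absurd (by rw [← e' m, hm, LinearMap.comp_zero]) hp

variable [IsArtinianRing A] [IsArtinianRing Aᵐᵒᵖ]

omit [IsArtinianRing Aᵐᵒᵖ] in
theorem exists_one_sub_mul_eq_one {a : A} (ha : a ∈ Ring.jacobson A) :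
    ∃ c, (1 - a) * c = 1 := by
  rw [← Ideal.jacobson_bot, Ideal.mem_jacobson_iff] at ha
  obtain ⟨c, hc⟩ := ha (-1)
  rw [Ideal.mem_bot, sub_eq_zero] at hc
  refine ⟨c, mul_eq_one_symm ?_⟩
  rw [mul_sub, mul_one, ← hc]
  noncomm_ring

omit [IsArtinianRing Aᵐᵒᵖ] in
theorem mem_jacobson_of_isSuperfluous {K : Submodule Aᵐᵒᵖ A} (hK : IsSuperfluous K) {y : A}
    (hy : y ∈ K) : y ∈ Ring.jacobson A := by
  rw [← Ideal.jacobson_bot, Ideal.mem_jacobson_iff]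
  intro b
  have h1 : LinearMap.range (leftMul (1 + y * b)) ⊔ K = ⊤ := by
    refine eq_top_iff.2 fun x _ => ?_
    refine Submodule.mem_sup.2 ⟨(1 + y * b) * x, ⟨x, rfl⟩, -(y * b * x), ?_, by noncomm_ring⟩
    rw [mul_assoc]
    exact K.neg_mem (K.smul_mem (op (b * x)) hy)
  obtain ⟨c, hc⟩ : ∃ c, (1 + y * b) * c = 1 := LinearMap.range_eq_top.1 (hK _ h1) 1
  -- If c inverts 1 + yb, then 1 − bcy inverts 1 + by. The left inverse needed in this identity is
  -- available because `A` is artinian.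
  refine ⟨1 - b * c * y, ?_⟩
  rw [Ideal.mem_bot]
  have h2 : (1 - b * c * y) * b * y + (1 - b * c * y) - 1
      = b * (1 - (c * (1 + y * b))) * y := by noncomm_ring
  rw [h2, mul_eq_one_symm hc, sub_self, mul_zero, zero_mul]

omit [IsArtinianRing Aᵐᵒᵖ] in
theorem jacobson_smul_eq_zero {S : Type*} [AddCommGroup S] [Module Aᵐᵒᵖ S] [IsSimpleModule Aᵐᵒᵖ S]
    {a : A} (ha : a ∈ Ring.jacobson A) (s : S) : op a • s = 0 := by
  by_contra h
  have h1 := IsSimpleModule.span_singleton_eq_top Aᵐᵒᵖ h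
  obtain ⟨b, hb⟩ := Submodule.mem_span_singleton.1 (h1 ▸ Submodule.mem_top (x := s))
  have h2 : op (1 - a * b.unop) • s = 0 := by
    rw [op_sub, op_one, sub_smul, one_smul, op_mul, mul_smul, op_unop, hb, sub_self]
  obtain ⟨c, hc⟩ := exists_one_sub_mul_eq_one (Ideal.mul_mem_right b.unop _ ha)
  have h3 : s = 0 := by
    rw [← one_smul Aᵐᵒᵖ s, ← op_one, ← hc, op_mul, mul_smul, h2, smul_zero]
  exact h (by rw [h3, smul_zero])

/-- A simple module at a vertex without loops has an extensible presentation. -/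
theorem IsBasicSystem.exists_presentation {n : ℕ} {e : Fin n → A} (he : IsBasicSystem A e)
    (hloop : ∀ i, ∀ z ∈ Ring.jacobson A, e i * z * e i ∈ Ring.jacobson A * Ring.jacobson A)
    (S : Type v) [AddCommGroup S] [Module Aᵐᵒᵖ S] [IsSimpleModule Aᵐᵒᵖ S] :
    ∃ (P₁ P₀ : Type v) (_ : AddCommGroup P₁) (_ : AddCommGroup P₀) (_ : Module Aᵐᵒᵖ P₁)
      (_ : Module Aᵐᵒᵖ P₀) (d : P₁ →ₗ[Aᵐᵒᵖ] P₀) (p : P₀ →ₗ[Aᵐᵒᵖ] S),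
      Module.Finite Aᵐᵒᵖ P₁ ∧ Module.Finite Aᵐᵒᵖ P₀ ∧ Module.Projective Aᵐᵒᵖ P₁ ∧
      Module.Projective Aᵐᵒᵖ P₀ ∧ Function.Surjective p ∧ Function.Exact d p ∧
      IsSuperfluous (LinearMap.ker d) ∧ IsExtensible d S := by
  have hP := he.isProjectiveSystem
  have hPf := hP.finite
  have hPp := hP.projective
  have hsum : ∀ s : S, s = ∑ j, op (e j) • s := fun s => by
    rw [← Finset.sum_smul, ← Finset.op_sum, he.1.complete, op_one, one_smul]
  have hnt := IsSimpleModule.nontrivial Aᵐᵒᵖ S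
  obtain ⟨y, hy⟩ := exists_ne (0 : S)
  obtain ⟨i, hi⟩ : ∃ i, op (e i) • y ≠ 0 := by
    by_contra! h
    exact hy (by rw [hsum y, Finset.sum_eq_zero fun j _ => h j])
  set x := op (e i) • y with hx
  have hxx : op (e i) • x = x := by rw [hx, ← mul_smul, ← op_mul, (he.2.1 i).1.eq]
  let p : Submodule.span Aᵐᵒᵖ {e i} →ₗ[Aᵐᵒᵖ] S := smulHom x (Submodule.subtype _)
  have hpx : ∀ a, p a = op (a : A) • x := fun a => rfl
  have hp0 : p ≠ 0 := fun h => hi (by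
    have := LinearMap.congr_fun h ⟨e i, Submodule.mem_span_singleton_self _⟩
    rwa [hpx, hxx] at this)
  have hp := LinearMap.surjective_of_ne_zero hp0
  have hK := isSuperfluous_ker_of_isSimpleModule (hP.indecomposable i) hp0
  have hKJ : ∀ a, p a = 0 → (a : A) ∈ Ring.jacobson A := fun a ha =>
    mem_jacobson_of_isSuperfluous (hK.map (Submodule.subtype _)) ⟨a, ha, rfl⟩
  have hSj : ∀ j, j ≠ i → ∀ s : S, op (e j) • s = 0 := fun j hj s => by
    have hempty : IsEmpty (Submodule.span Aᵐᵒᵖ {e i} ≃ₗ[Aᵐᵒᵖ] Submodule.span Aᵐᵒᵖ {e j}) :=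
      ⟨fun f => hj (he.2.2 _ _ ⟨f⟩).symm⟩
    have := eq_zero_of_isSimpleModule (hP.indecomposable i) (hP.indecomposable j) hp0 hempty
      (smulHom s (Submodule.subtype _))
    exact LinearMap.congr_fun this ⟨e j, Submodule.mem_span_singleton_self _⟩
  have hSi : ∀ s : S, op (e i) • s = s := fun s => by
    conv_rhs => rw [hsum s]
    rw [Finset.sum_eq_single i (fun j _ hj => hSj j hj s) (fun h => absurd (Finset.mem_univ i) h)]
  obtain ⟨m, N, q, hNp, hNf, hq, hqs⟩ := exists_projectiveCover Aᵐᵒᵖ (LinearMap.ker p)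
  let d : N →ₗ[Aᵐᵒᵖ] Submodule.span Aᵐᵒᵖ {e i} := (LinearMap.ker p).subtype ∘ₗ q
  have hker : LinearMap.ker d = LinearMap.ker q := by
    rw [LinearMap.ker_comp, Submodule.ker_subtype, Submodule.comap_bot]
  have hex : Function.Exact d p := by
    rw [LinearMap.exact_iff, LinearMap.range_comp, LinearMap.range_eq_top.2 hq]
    simp
  -- The remaining claim is Hom(N, S) = 0, so the zero map serves as extension.
  refine ⟨N, _, _, _, _, _, d, p, hNf, hPf i, hNp, hPp i, hp, hex, hker ▸ hqs, fun a => ⟨0, ?_⟩⟩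
  -- Otherwise `a` maps `ker d` onto the simple module `S`, so `ker a` and the superfluous `ker q`
  -- span `N`, forcing a = 0. Thus `a` descends to the kernel of `p`.
  have hak : ∀ w, d w = 0 → a w = 0 := by
    by_contra! h
    obtain ⟨w, hw, hw0⟩ := h
    have hsup : LinearMap.ker a ⊔ LinearMap.ker q = ⊤ := by
      refine eq_top_iff.2 fun t _ => ?_
      have h1 := IsSimpleModule.span_singleton_eq_top Aᵐᵒᵖ hw0
      obtain ⟨r, hr⟩ := Submodule.mem_span_singleton.1 (h1 ▸ Submodule.mem_top (x := a t))
      refine Submodule.mem_sup.2 ⟨t - r • w, ?_, r • w, ?_, sub_add_cancel _ _⟩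
      · rw [LinearMap.mem_ker, map_sub, map_smul, hr, sub_self]
      · rw [← hker]
        exact Submodule.smul_mem _ _ hw
    have := hqs _ hsup
    exact hw0 (LinearMap.mem_ker.1 (this ▸ Submodule.mem_top (x := w)))
  -- For z = bc, the element eᵢb already lies in `ker p`, and `a` kills its multiples by the radical
  -- element c.
  have hJJ : ∀ z ∈ Ring.jacobson A * Ring.jacobson A, ∃ w, (d w : A) = e i * z ∧ a w = 0 := by
    intro z hz
    rw [← smul_eq_mul] at hz
    refine Submodule.smul_induction_on hz (fun b hb c hc => ?_) fun z₁ z₂ h₁ h₂ => ?_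
    · have hmem : e i * b ∈ Submodule.span Aᵐᵒᵖ {e i} := by
        rw [mem_span_idempotent (he.2.1 i).1, ← mul_assoc, (he.2.1 i).1.eq]
      have h1 : p ⟨e i * b, hmem⟩ = 0 := by
        rw [hpx, op_mul, mul_smul, hxx, jacobson_smul_eq_zero hb]
      obtain ⟨w, hw⟩ := (hex _).1 h1
      refine ⟨op c • w, ?_, ?_⟩
      · rw [map_smul, hw]
        exact mul_assoc _ _ _
      · rw [map_smul, jacobson_smul_eq_zero hc]
    · obtain ⟨w₁, h₁, h₁'⟩ := h₁
      obtain ⟨w₂, h₂, h₂'⟩ := h₂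
      exact ⟨w₁ + w₂, by rw [map_add, Submodule.coe_add, h₁, h₂, mul_add],
        by rw [map_add, h₁', h₂', add_zero]⟩
  rw [LinearMap.zero_comp]
  ext w
  -- As eᵢ acts as the identity on `S`, w may be replaced by w·eᵢ, whose image eᵢ d(w) eᵢ lies in
  -- the square of the radical for lack of loops.
  rw [LinearMap.zero_apply, ← hSi (a w), ← map_smul]
  have h1 : ((d w : A)) ∈ Ring.jacobson A := hKJ _ (hex.apply_apply_eq_zero w)
  have h2 : e i * (d w : A) = d w := (mem_span_idempotent (he.2.1 i).1).1 (d w).2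
  obtain ⟨w', hw', ha⟩ := hJJ _ (hloop i _ h1)
  have h3 : d (op (e i) • w - w') = 0 := by
    rw [map_sub, map_smul, sub_eq_zero]
    ext
    rw [hw', ← mul_assoc, ← mul_assoc, (he.2.1 i).1.eq, h2]
    rfl
  have h4 := hak _ h3
  rw [map_sub, ha, sub_zero] at h4
  exact h4.symm

theorem isIndecomposable_of_isSimpleModule {R S : Type*} [Ring R] [AddCommGroup S] [Module R S]
    [IsSimpleModule R S] : IsIndecomposable R S := by
  refine ⟨IsSimpleModule.nontrivial R S, fun U V hUV => ?_⟩
  rcases eq_bot_or_eq_top U with h | h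
  · exact .inl h
  · right
    simpa [h] using hUV.inf_eq_bot

end SimpleModules

/-! ### Projective dimension and Ext. -/

section HomologicalAlgebra

open CategoryTheory

variable {R : Type v} [Ring R] {X Y Z : Type v} [AddCommGroup X] [Module R X]
  [AddCommGroup Y] [Module R Y] [AddCommGroup Z] [Module R Z]

/-- A composable pair of homomorphisms with composition zero, as a short complex. -/
abbrev moduleShortComplex (f : X →ₗ[R] Y) (g : Y →ₗ[R] Z) (h : Function.Exact f g) :
    ShortComplex (ModuleCat.{v} R) :=
  ShortComplex.mk (ModuleCat.ofHom f) (ModuleCat.ofHom g) (by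
    rw [← ModuleCat.ofHom_comp, h.linearMap_comp_eq_zero]; rfl)

theorem shortExact_moduleShortComplex {f : X →ₗ[R] Y} {g : Y →ₗ[R] Z} (h : Function.Exact f g)
    (hf : Function.Injective f) (hg : Function.Surjective g) :
    (moduleShortComplex f g h).ShortExact :=
  ModuleCat.shortComplex_shortExact _ h hf hg

theorem projective_of (X : Type v) [AddCommGroup X] [Module R X] [Module.Projective R X] :
    Projective (ModuleCat.of R X) := (IsProjective.iff_projective X).1 inferInstance

theorem hasProjectiveDimensionLE_one_of_exact [Module.Projective R X] [Module.Projective R Y]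
    {f : X →ₗ[R] Y} {g : Y →ₗ[R] Z} (h : Function.Exact f g)
    (hf : Function.Injective f) (hg : Function.Surjective g) :
    HasProjectiveDimensionLE (ModuleCat.of R Z) 1 := by
  have := projective_of (R := R) X
  have := projective_of (R := R) Y
  exact (shortExact_moduleShortComplex h hf hg).hasProjectiveDimensionLT_X₃ 1
    (inferInstanceAs (HasProjectiveDimensionLT (ModuleCat.of R X) 1))
    (inferInstanceAs (HasProjectiveDimensionLT (ModuleCat.of R Y) 2))

/-- Since Ext¹(Y, Z) = 0, every class in Ext¹(Z, Z) is the image of some map X → Z under the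
connecting map. Such a map factors through `f`, and `f` annihilates the extension class. -/
theorem subsingleton_ext_of_isExtensible [Module.Projective R Y]
    {f : X →ₗ[R] Y} {g : Y →ₗ[R] Z} (h : Function.Exact f g)
    (hf : Function.Injective f) (hg : Function.Surjective g) (hext : IsExtensible f Z) :
    Subsingleton (Abelian.Ext (ModuleCat.of R Z) (ModuleCat.of R Z) 1) := by
  have := projective_of (R := R) Y
  have hS := shortExact_moduleShortComplex h hf hg
  refine subsingleton_of_forall_eq 0 fun x => ?_
  obtain ⟨x₁, rfl⟩ := Abelian.Ext.contravariant_sequence_exact₃ hS (ModuleCat.of R Z) x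
    (Abelian.Ext.eq_zero_of_projective _) (add_zero 1)
  obtain ⟨a, rfl⟩ := Abelian.Ext.homEquiv₀.symm.surjective x₁
  obtain ⟨b, hb⟩ := hext a.hom
  have ha : a = ModuleCat.ofHom f ≫ ModuleCat.ofHom b := by
    ext x
    exact (LinearMap.congr_fun hb x).symm
  change hS.extClass.comp (Abelian.Ext.mk₀ a) (add_zero 1) = 0
  rw [ha, ← Abelian.Ext.mk₀_comp_mk₀]
  exact hS.extClass_comp_assoc _

theorem hasProjectiveDimensionLE_of_isRetract (h : IsRetract R X Y) (n : ℕ)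
    (hY : HasProjectiveDimensionLE (ModuleCat.of R Y) n) :
    HasProjectiveDimensionLE (ModuleCat.of R X) n := by
  obtain ⟨i, r, hir⟩ := h
  exact Retract.hasProjectiveDimensionLT
    { i := ModuleCat.ofHom i
      r := ModuleCat.ofHom r
      retract := by rw [← ModuleCat.ofHom_comp, hir]; rfl } (n + 1)

/-- The bound is closed under extensions, so a composition series reduces it to simple modules. -/
theorem hasProjectiveDimensionLE_of_isFiniteLength (n : ℕ)
    (h : ∀ (S : Type v) [AddCommGroup S] [Module R S] [IsSimpleModule R S],
      HasProjectiveDimensionLE (ModuleCat.of R S) n) (hX : IsFiniteLength R X) :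
    HasProjectiveDimensionLE (ModuleCat.of R X) n := by
  induction hX with
  | of_subsingleton =>
    rename_i M _ _ _
    have h0 : HasProjectiveDimensionLT (ModuleCat.of R M) 0 :=
      (ModuleCat.isZero_of_subsingleton (ModuleCat.of R M)).hasProjectiveDimensionLT_zero
    exact hasProjectiveDimensionLT_of_ge _ 0 _ (Nat.zero_le _)
  | of_simple_quotient hN ih =>
    rename_i M _ _ N _
    exact (shortExact_moduleShortComplex (LinearMap.exact_subtype_mkQ N) N.injective_subtype
      N.mkQ_surjective).hasProjectiveDimensionLT_X₂ (n + 1) ih (h (M ⧸ N))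

theorem projective_of_hasProjectiveDimensionLE [Module.Projective R Y]
    {f : X →ₗ[R] Y} {g : Y →ₗ[R] Z} (h : Function.Exact f g) (hf : Function.Injective f)
    (hg : Function.Surjective g) (hZ : HasProjectiveDimensionLE (ModuleCat.of R Z) 1) :
    Module.Projective R X := by
  have := projective_of (R := R) Y
  have := (shortExact_moduleShortComplex h hf hg).hasProjectiveDimensionLT_X₁ 1
    (inferInstanceAs (HasProjectiveDimensionLT (ModuleCat.of R Y) 1)) hZ
  exact (IsProjective.iff_projective X).2 (projective_iff_hasProjectiveDimensionLT_one.2 this)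

end HomologicalAlgebra

/-! ### Submodules of projectives over a hereditary ring. -/

section Submodules

theorem projective_of_surjective {R X Y : Type*} [Ring R] [AddCommGroup X] [Module R X]
    [AddCommGroup Y] [Module R Y] [Module.Projective R Y] {f : X →ₗ[R] Y}
    (hf : Function.Surjective f) [Module.Projective R (LinearMap.ker f)] :
    Module.Projective R X := by
  obtain ⟨s, hs⟩ := Module.projective_lifting_property f LinearMap.id hf
  have hs' : ∀ y, f (s y) = y := fun y => LinearMap.congr_fun hs y
  refine Module.Projective.of_split (M := LinearMap.ker f × Y)
    (((LinearMap.id - s ∘ₗ f).codRestrict _ fun x => ?_).prod f)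
    ((Submodule.subtype _).coprod s) ?_
  · ext x
    simp
  · simp [hs']

/-- The first coordinate maps `K` onto an ideal, which is projective by hypothesis, and the kernel
of this map embeds into the free module on the other coordinates. -/
theorem projective_submodule_pi {R : Type*} [Ring R]
    (h : ∀ I : Submodule R R, Module.Projective R I) (n : ℕ) (K : Submodule R (Fin n → R)) :
    Module.Projective R K := by
  induction n with
  | zero => exact Module.Projective.of_free
  | succ n ih =>
    let f : K →ₗ[R] R := LinearMap.proj 0 ∘ₗ K.subtype
    have := h (LinearMap.range f)
    have h1 : LinearMap.ker f.rangeRestrict = LinearMap.ker f := LinearMap.ker_rangeRestrict f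
    let t : LinearMap.ker f.rangeRestrict →ₗ[R] (Fin n → R) :=
      LinearMap.pi (fun i => LinearMap.proj i.succ) ∘ₗ K.subtype ∘ₗ Submodule.subtype _
    have ht : Function.Injective t := by
      intro x y hxy
      have hf : ∀ z : LinearMap.ker f.rangeRestrict, f z = 0 := fun z => by
        rw [← LinearMap.mem_ker, ← h1]
        exact z.2
      refine Subtype.ext (Subtype.ext (funext fun i => ?_))
      refine Fin.cases ?_ (fun i => ?_) i
      · exact (hf x).trans (hf y).symm
      · exact congrFun hxy i
    have := ih (LinearMap.range t)
    have : Module.Projective R (LinearMap.ker f.rangeRestrict) :=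
      Module.Projective.of_equiv (LinearEquiv.ofInjective t ht).symm
    exact projective_of_surjective f.surjective_rangeRestrict

theorem projective_submodule {R P : Type*} [Ring R]
    (h : ∀ I : Submodule R R, Module.Projective R I) [AddCommGroup P] [Module R P]
    [Module.Finite R P] [Module.Projective R P] (K : Submodule R P) : Module.Projective R K := by
  obtain ⟨n, f, hf⟩ := Module.Finite.exists_fin' R P
  obtain ⟨g, hg⟩ := Module.projective_lifting_property f LinearMap.id hf
  have hinj : Function.Injective (g ∘ₗ K.subtype) := fun a b hab => by
    have := congrArg f hab
    have e : ∀ x, f (g x) = x := fun x => LinearMap.congr_fun hg x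
    simpa [e] using this
  have := projective_submodule_pi h n (LinearMap.range (g ∘ₗ K.subtype))
  exact Module.Projective.of_equiv (LinearEquiv.ofInjective _ hinj).symm

end Submodules

/-! ### From right ideals to left ideals by duality. -/

section LeftHereditary

open MulOpposite

variable (k : Type u) {A : Type v} [Field k] [Ring A] [Algebra k A]

/-- The dual of a homomorphism of left modules. -/
def kDualMap {N N' : Type*} [AddCommGroup N] [Module k N] [Module A N] [IsScalarTower k A N]
    [AddCommGroup N'] [Module k N'] [Module A N'] [IsScalarTower k A N'] (f : N →ₗ[A] N') :
    KDual k N' →ₗ[Aᵐᵒᵖ] KDual k N where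
  toFun φ := (show N' →ₗ[k] k from φ) ∘ₗ f.restrictScalars k
  map_add' _ _ := rfl
  map_smul' a φ := LinearMap.ext fun x =>
    congrArg (show N' →ₗ[k] k from φ) (f.map_smul a.unop x).symm

/-- Over a right hereditary algebra the duals of left ideals are injective. -/
theorem baer_kDual (hA : ∀ I : Submodule Aᵐᵒᵖ A, Module.Projective Aᵐᵒᵖ I) (I : Submodule A A) :
    Module.Baer Aᵐᵒᵖ (KDual k I) := by
  intro K g
  have hK : Module.Projective Aᵐᵒᵖ K := by
    have := hA (Submodule.map (opRegularEquiv A).symm.toLinearMap K)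
    exact Module.Projective.of_equiv (Submodule.equivMapOfInjective _
      (opRegularEquiv A).symm.injective K).symm
  -- As `K` is projective, `g` lifts along the restriction D A → D I, so it remains to extend a map
  -- into D A.
  have hres : Function.Surjective (kDualMap k I.subtype) := fun φ => by
    obtain ⟨ψ, hψ⟩ := LinearMap.exists_extend (p := I.restrictScalars k)
      (show I.restrictScalars k →ₗ[k] k from φ)
    exact ⟨ψ, hψ⟩
  obtain ⟨g', hg'⟩ := Module.projective_lifting_property _ g hres
  let g₁ : K → A →ₗ[k] k := fun x => g' x
  have g₁_smul : ∀ (a b : A) (x : K), g₁ (op a • x) b = g₁ x (a * b) := fun a b x =>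
    LinearMap.congr_fun (show g₁ (op a • x) = _ from map_smul g' (op a) x) b
  have g₁_algebraMap : ∀ (c : k) (x : K), g₁ (op (algebraMap k A c) • x) 1 = c • g₁ x 1 :=
    fun c x => by rw [g₁_smul, mul_one, ← map_smul, Algebra.algebraMap_eq_smul_one]
  -- A homomorphism into D A is determined by the linear functional x ↦ g'(x)(1), which extends from
  -- `K` to the whole algebra by linear algebra alone.
  let l : K.restrictScalars k →ₗ[k] k :=
    { toFun := fun x => g₁ x 1
      map_add' := fun x y => LinearMap.congr_fun (map_add g' x y : g₁ (x + y) = _) 1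
      map_smul' := fun c x => by
        have h1 : (c • x : K.restrictScalars k) =
            (op (algebraMap k A c) • (show K from x) : K) := Subtype.ext (Algebra.smul_def c _)
        exact (congrArg (fun y : K => g₁ y 1) h1).trans (g₁_algebraMap c x) }
  obtain ⟨L, hL⟩ := LinearMap.exists_extend l
  let G : Aᵐᵒᵖ →ₗ[Aᵐᵒᵖ] KDual k A :=
    { toFun := fun y => L ∘ₗ
        { toFun := fun a => op a * y
          map_add' := fun a b => by rw [op_add, add_mul]
          map_smul' := fun c a => by rw [op_smul, smul_mul_assoc, RingHom.id_apply] }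
      map_add' := fun y z => LinearMap.ext fun a => by
        change L (op a * (y + z)) = L (op a * y) + L (op a * z)
        rw [mul_add, map_add]
      map_smul' := fun b y => LinearMap.ext fun a => by
        change L (op a * (b * y)) = L (op (b.unop * a) * y)
        rw [op_mul, op_unop, mul_assoc] }
  refine ⟨kDualMap k I.subtype ∘ₗ G, fun x hx => ?_⟩
  rw [← hg']
  refine LinearMap.ext fun a => ?_
  change L (op (a : A) * x) = g₁ ⟨x, hx⟩ a
  have h1 : L (op (a : A) * x) = g₁ (op (a : A) • ⟨x, hx⟩) 1 :=
    LinearMap.congr_fun hL (op (a : A) • (⟨x, hx⟩ : K))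
  rw [h1, g₁_smul, mul_one]

/-- A surjection π from Aᵐ onto `I` dualises to an injection, which splits because D I is injective.
Dualising the retraction back, with Aᵐ identified with its double dual, gives a section of π. -/
theorem projective_of_forall_projective_op [FiniteDimensional k A]
    (hA : ∀ I : Submodule Aᵐᵒᵖ A, Module.Projective Aᵐᵒᵖ I) (I : Submodule A A) :
    Module.Projective A I := by
  have : IsNoetherianRing A := isNoetherian_of_tower k inferInstance
  obtain ⟨m, π, hπ⟩ := Module.Finite.exists_fin' A I
  have hinj : Function.Injective (kDualMap k π) := fun φ ψ h => LinearMap.ext fun x => by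
    obtain ⟨y, rfl⟩ := hπ x
    exact LinearMap.congr_fun h y
  obtain ⟨r, hr⟩ := (baer_kDual k hA I).extension_property (kDualMap k π) hinj LinearMap.id
  let r₁ : Module.Dual k (Fin m → A) → I →ₗ[k] k := fun φ => r φ
  have r₁_add : ∀ φ ψ, r₁ (φ + ψ) = r₁ φ + r₁ ψ := fun φ ψ => map_add r φ ψ
  have r₁_smul : ∀ (c : k) φ, r₁ (c • φ) = c • r₁ φ := fun c φ => by
    have h1 : (c • φ : Module.Dual k (Fin m → A)) =
        (op (algebraMap k A c) • (show KDual k (Fin m → A) from φ) : KDual k (Fin m → A)) :=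
      LinearMap.ext fun x => by
        change c • φ x = φ (algebraMap k A c • x)
        rw [algebraMap_smul, map_smul]
    refine LinearMap.ext fun x => ?_
    have h2 := LinearMap.congr_fun (show r₁ (c • φ) = _ from
      (congrArg r h1).trans
        (r.map_smul (op (algebraMap k A c)) (show KDual k (Fin m → A) from φ))) x
    refine h2.trans ?_
    change r₁ φ (algebraMap k A c • x) = c • r₁ φ x
    rw [algebraMap_smul, map_smul]
  -- The vector `s₁ x` is the one representing the functional φ ↦ r(φ)(x) on the dual of Aᵐ.
  let s₁ : I → Fin m → A := fun x => (Module.evalEquiv k (Fin m → A)).symm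
    { toFun := fun φ => r₁ φ x
      map_add' := fun φ ψ => by rw [r₁_add]; rfl
      map_smul' := fun c φ => by rw [r₁_smul]; rfl }
  have hs₁ : ∀ x (φ : Module.Dual k (Fin m → A)), φ (s₁ x) = r₁ φ x := fun x φ =>
    Module.apply_evalEquiv_symm_apply k (Fin m → A) φ _
  have hext : ∀ {y z : Fin m → A}, (∀ φ : Module.Dual k (Fin m → A), φ y = φ z) → y = z :=
    fun {y z} h => by
      rw [← sub_eq_zero, ← Module.forall_dual_apply_eq_zero_iff k]
      exact fun φ => by rw [map_sub, h, sub_self]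
  let s : I →ₗ[A] Fin m → A :=
    { toFun := s₁
      map_add' := fun x y => hext fun φ => by rw [map_add, hs₁, hs₁, hs₁, map_add]
      map_smul' := fun a x => hext fun φ => by
        have h1 : r₁ (φ ∘ₗ DistribSMul.toLinearMap k (Fin m → A) a) x = r₁ φ (a • x) :=
          LinearMap.congr_fun (show r₁ (φ ∘ₗ DistribSMul.toLinearMap k (Fin m → A) a) = _ from
            r.map_smul (op a) (show KDual k (Fin m → A) from φ)) x
        rw [hs₁, ← h1, ← hs₁]
        rfl }
  refine Module.Projective.of_split s π (LinearMap.ext fun x => ?_)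
  rw [← sub_eq_zero, ← Module.forall_dual_apply_eq_zero_iff k]
  intro ψ
  have h1 : ψ (π (s₁ x)) = r₁ (ψ ∘ₗ π.restrictScalars k) x := hs₁ x (ψ ∘ₗ π.restrictScalars k)
  have h2 : r₁ (ψ ∘ₗ π.restrictScalars k) = ψ := LinearMap.congr_fun hr ψ
  rw [map_sub, sub_eq_zero]
  change ψ (π (s₁ x)) = ψ x
  rw [h1, h2]

end LeftHereditary

/-! ### Closure properties of add T. -/

section Add

variable {R : Type v} [Ring R] {T X Y : Type w} [AddCommGroup T] [Module R T]
  [AddCommGroup X] [Module R X] [AddCommGroup Y] [Module R Y]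

theorem IsRetract.inAdd {n : ℕ} (h : IsRetract R X (Fin n → T)) : InAdd R T X := ⟨n, h⟩

theorem InAdd.of_isRetract (h : InAdd R T Y) (hr : IsRetract R X Y) : InAdd R T X := by
  obtain ⟨n, h⟩ := h
  exact (hr.trans h).inAdd

theorem InAdd.prod (hX : InAdd R T X) (hY : InAdd R T Y) : InAdd R T (X × Y) := by
  obtain ⟨n, i, r, h⟩ := hX
  obtain ⟨m, i', r', h'⟩ := hY
  have h1 : IsRetract R (X × Y) ((Fin n → T) × (Fin m → T)) :=
    ⟨i.prodMap i', r.prodMap r', by rw [LinearMap.prodMap_comp, h, h', LinearMap.prodMap_id]⟩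
  exact (h1.trans (.of_equiv ((LinearEquiv.sumArrowLequivProdArrow (Fin n) (Fin m) R T).symm.trans
    (LinearEquiv.funCongrLeft R T finSumFinEquiv.symm)))).inAdd

theorem inAdd_of_isIndecomposable [IsArtinianRing R] [Module.Finite R X]
    (h : ∀ U : Submodule R X, IsRetract R U X → IsIndecomposable R U → InAdd R T U) :
    InAdd R T X := by
  refine InAdd.of_isRetract (induction_on_isIndecomposable (fun U => InAdd R T U) ?_ h
    fun U V hUV hU hV => (hU.prod hV).of_isRetract (.of_equiv (prodEquivSup hUV).symm))
    (.of_equiv Submodule.topEquiv.symm)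
  exact ⟨0, 0, 0, Subsingleton.elim _ _⟩

end Add

/-! ### The two directions of the theorem. -/

section TauTiltingTheorem

variable (k : Type u) {A : Type v} [Field k] [Ring A] [Algebra k A] [FiniteDimensional k A]

/-- The sum of `M` with the Bongartz module is rigid and so has at most `n` indecomposable summands
up to isomorphism; `M` already supplies `n`. -/
theorem isRetract_of_isRetract_bongartzModule {R : Type v} [Ring R] [Algebra k R]
    [FiniteDimensional k R] [IsArtinianRing R] {n : ℕ} {P : Fin n → Type v}
    [∀ j, AddCommGroup (P j)] [∀ j, Module R (P j)] (hP : IsProjectiveSystem R P)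
    {P₁ P₀ M Q X : Type v} [AddCommGroup P₁] [Module R P₁] [AddCommGroup P₀] [Module R P₀]
    [AddCommGroup M] [Module R M] [AddCommGroup Q] [Module R Q] [AddCommGroup X] [Module R X]
    [Module.Finite R P₀] [Module.Finite R Q] [Module.Projective R P₁]
    [Module.Projective R P₀] [Module.Projective R Q]
    {d : P₁ →ₗ[R] P₀} {p : P₀ →ₗ[R] M} (hp : Function.Surjective p) (hdp : Function.Exact d p)
    (hM : IsExtensible d M) (hn : numSummands R M = n) {m : ℕ} {φ : (Fin m → P₁) →ₗ[R] Q}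
    (hφ : IsApproximation d φ) (hX : IsIndecomposable R X)
    (hr : IsRetract R X (BongartzModule d φ)) : IsRetract R X M := by
  have : Module.Finite R M := Module.Finite.of_surjective p hp
  let N := M × (Unit → BongartzModule d φ)
  have hN : IsRigid R N := isRigid_prod_bongartzModule hp hdp hM (ι := Unit) fun _ => hφ
  let := scalarModule k R N
  have := isScalarTower_scalarModule k R N
  have hNf : Module.Finite R N := inferInstance
  have := Module.Finite.trans (R := k) R N
  have hle := hP.numSummands_le k N hN
  exact isRetract_of_numSummands_le (M' := N) .prod_left (hn ▸ ENat.natCast_ne_top n)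
    (hn ▸ hle) hX
    ((hr.trans (.pi_apply (fun _ : Unit => BongartzModule d φ) ())).trans .prod_right)

/-- Over a right hereditary algebra the first map in a minimal projective presentation is
injective. -/
theorem injective_of_projective_submodule {R P₁ P₀ : Type v} [Ring R]
    (h : ∀ I : Submodule R R, Module.Projective R I) [AddCommGroup P₁] [Module R P₁]
    [AddCommGroup P₀] [Module R P₀] [Module.Finite R P₀] [Module.Projective R P₀]
    {d : P₁ →ₗ[R] P₀} (hd : IsSuperfluous (LinearMap.ker d)) : Function.Injective d := by
  -- The image of `d` is projective, so `ker d` is a direct summand; being superfluous, it vanishes.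
  have := projective_submodule h (LinearMap.range d)
  obtain ⟨s, hs⟩ := Module.projective_lifting_property d.rangeRestrict LinearMap.id
    d.surjective_rangeRestrict
  obtain ⟨-, hc⟩ := exists_isCompl_of_split (X := LinearMap.range d) hs
  rw [LinearMap.ker_rangeRestrict] at hc
  rw [hd _ hc.sup_eq_top] at hc
  rw [← LinearMap.ker_eq_bot]
  simpa using hc.inf_eq_bot

/-- Up to a sign, the cokernel is the pushout of 0 → P₁ᵐ → P₀ᵐ → Mᵐ → 0 along `φ`. -/
theorem exists_exact_bongartzModule {R P₁ P₀ M Q : Type v} [Ring R] [AddCommGroup P₁]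
    [Module R P₁] [AddCommGroup P₀] [Module R P₀] [AddCommGroup M] [Module R M] [AddCommGroup Q]
    [Module R Q] {d : P₁ →ₗ[R] P₀} {p : P₀ →ₗ[R] M} (hp : Function.Surjective p)
    (hdp : Function.Exact d p) (hd : Function.Injective d) {m : ℕ} (φ : (Fin m → P₁) →ₗ[R] Q) :
    ∃ (f : Q →ₗ[R] BongartzModule d φ) (g : BongartzModule d φ →ₗ[R] Fin m → M),
      Function.Injective f ∧ Function.Exact f g ∧ Function.Surjective g := by
  let D : (Fin m → P₁) →ₗ[R] Fin m → P₀ := LinearMap.piMap fun _ => d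
  let p' : (Fin m → P₀) →ₗ[R] Fin m → M := LinearMap.piMap fun _ => p
  have hex : Function.Exact D p' := exact_piMap fun _ => hdp
  let π := (LinearMap.range (bongartzMap d φ)).mkQ
  let g : BongartzModule d φ →ₗ[R] Fin m → M :=
    (LinearMap.range (bongartzMap d φ)).liftQ (p' ∘ₗ LinearMap.fst R _ _) (by
      rintro _ ⟨x, rfl⟩
      exact hex.apply_apply_eq_zero x)
  have hg : ∀ x, g (π x) = p' x.1 := fun x => rfl
  refine ⟨π ∘ₗ LinearMap.inr R _ _, g, ?_, fun y => ⟨fun hy => ?_, ?_⟩, fun y => ?_⟩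
  · refine (injective_iff_map_eq_zero (π ∘ₗ LinearMap.inr R _ _)).2 fun a ha => ?_
    obtain ⟨x, hx⟩ := (Submodule.Quotient.mk_eq_zero _).1 ha
    have h1 : D x = 0 := congrArg Prod.fst hx
    have h2 : φ x = a := congrArg Prod.snd hx
    have h3 : x = 0 := funext fun i => hd ((congrFun h1 i).trans (map_zero d).symm)
    rw [← h2, h3, map_zero]
  · obtain ⟨⟨x, q⟩, rfl⟩ := Submodule.mkQ_surjective _ y
    obtain ⟨z, hz⟩ := (hex x).1 hy
    refine ⟨q - φ z, ?_⟩
    rw [LinearMap.comp_apply, ← sub_eq_zero]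
    refine (map_sub π _ _).symm.trans ((Submodule.Quotient.mk_eq_zero _).2 ⟨-z, ?_⟩)
    refine Prod.ext ?_ ?_
    · change D (-z) = 0 - x
      rw [map_neg, hz, zero_sub]
    · change φ (-z) = q - φ z - q
      rw [map_neg]
      abel
  · rintro ⟨q, rfl⟩
    exact map_zero p'
  · obtain ⟨x, hx⟩ := (Function.Surjective.piMap fun _ : Fin m => hp) y
    exact ⟨π (x, 0), hx⟩

/-- Over a right hereditary basic algebra every `τ`-tilting module is tilting. -/
theorem IsTauTilting.isTilting {n : ℕ} {e : Fin n → A} (he : IsBasicSystem A e)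
    (hA : ∀ I : Submodule Aᵐᵒᵖ A, Module.Projective Aᵐᵒᵖ I) {M : Type v} [AddCommGroup M]
    [Module Aᵐᵒᵖ M] [Module.Finite Aᵐᵒᵖ M] (hM : IsTauTilting k A M) : IsTilting A M := by
  have : IsArtinianRing Aᵐᵒᵖ := isArtinian_of_tower k inferInstance
  obtain ⟨hrig, hn⟩ := hM
  rw [he.numSummands k] at hn
  let π := minimalPresentation k A M
  have hext : IsExtensible π.d M := isExtensible_of_forall_eq_zero k π hrig
  have hA' : ∀ I : Submodule Aᵐᵒᵖ Aᵐᵒᵖ, Module.Projective Aᵐᵒᵖ I := fun I => by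
    have := hA (Submodule.map (opRegularEquiv A).symm.toLinearMap I)
    exact Module.Projective.of_equiv (Submodule.equivMapOfInjective _
      (opRegularEquiv A).symm.injective I).symm
  have hd := injective_of_projective_submodule hA' π.superfluous₁
  refine ⟨hasProjectiveDimensionLE_one_of_exact π.exact hd π.surjective,
    subsingleton_ext_of_isExtensible π.exact hd π.surjective hext, ?_⟩
  let := scalarModule k Aᵐᵒᵖ π.P₁
  let := scalarModule k Aᵐᵒᵖ π.P₀
  have := isScalarTower_scalarModule k Aᵐᵒᵖ π.P₁
  have := isScalarTower_scalarModule k Aᵐᵒᵖ π.P₀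
  -- Taking Q = A produces the coresolution of `A` required of a tilting module.
  obtain ⟨m, φ, hφ⟩ := exists_isApproximation k (Q := A) π.d
  obtain ⟨f, g, hf, hfg, hg⟩ := exists_exact_bongartzModule π.surjective π.exact hd φ
  refine ⟨ModuleCat.of Aᵐᵒᵖ (BongartzModule π.d φ), ModuleCat.of Aᵐᵒᵖ (Fin m → M), f, g,
    ?_, IsRetract.refl.inAdd, hf, hfg, hg⟩
  exact inAdd_of_isIndecomposable fun U hU hUi =>
    (((isRetract_of_isRetract_bongartzModule k he.isProjectiveSystem π.surjective π.exact hext hn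
      hφ hUi hU).trans (.pi_apply (fun _ : Fin 1 => M) 0))).inAdd

theorem arrowSpace_eq_bot_iff (k : Type u) {A : Type v} [Field k] [Ring A] [Algebra k A]
    {a b : A} : arrowSpace k a b = ⊥ ↔
    ∀ z ∈ Ring.jacobson A, a * z * b ∈ Ring.jacobson A * Ring.jacobson A := by
  rw [arrowSpace, ← le_bot_iff, Submodule.map_le_iff_le_comap, ← LinearMap.ker]
  refine forall₂_congr fun z _ => ?_
  rw [LinearMap.mem_ker, LinearMap.comp_apply, Submodule.mkQ_apply, Submodule.Quotient.mk_eq_zero,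
    LinearMap.comp_apply, LinearMap.mulRight_apply, LinearMap.mulLeft_apply, mul_assoc,
    Submodule.restrictScalars_mem]

theorem isEmpty_hom_iff (hA : IsBasicAlgebra A) (x y : OrdinaryQuiver k hA) :
    IsEmpty (x ⟶ y) ↔ ∀ z ∈ Ring.jacobson A,
      x.idem * z * y.idem ∈ Ring.jacobson A * Ring.jacobson A := by
  rw [← arrowSpace_eq_bot_iff k, ← Submodule.finrank_eq_zero]
  change IsEmpty (Fin _) ↔ _
  rw [← Fintype.card_eq_zero_iff, Fintype.card_fin]

/-- If the ordinary quiver has no loop and all `τ`-tilting modules have projective dimension at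
most one, then so do the simple modules. -/
theorem hasProjectiveDimensionLE_of_isSimpleModule {n : ℕ} {e : Fin n → A}
    (he : IsBasicSystem A e)
    (hloop : ∀ i, ∀ z ∈ Ring.jacobson A, e i * z * e i ∈ Ring.jacobson A * Ring.jacobson A)
    (h : ∀ (M : Type v) [AddCommGroup M] [Module Aᵐᵒᵖ M] [Module.Finite Aᵐᵒᵖ M],
      IsBasicModule Aᵐᵒᵖ M → IsTauTilting k A M →
        CategoryTheory.HasProjectiveDimensionLE (ModuleCat.of Aᵐᵒᵖ M) 1)
    (S : Type v) [AddCommGroup S] [Module Aᵐᵒᵖ S] [IsSimpleModule Aᵐᵒᵖ S] :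
    CategoryTheory.HasProjectiveDimensionLE (ModuleCat.of Aᵐᵒᵖ S) 1 := by
  have : IsArtinianRing Aᵐᵒᵖ := isArtinian_of_tower k inferInstance
  have : IsArtinianRing A := isArtinian_of_tower k inferInstance
  obtain ⟨P₁, P₀, _, _, _, _, d, p, _, _, _, _, hp, hdp, hd, hS⟩ :=
    he.exists_presentation hloop S
  obtain ⟨M, _, _, hMf, hMb, hMr, hMn, hMS⟩ := he.isProjectiveSystem.exists_completion k hp hdp hd
    hS isIndecomposable_of_isSimpleModule
  refine hasProjectiveDimensionLE_of_isRetract hMS 1 (h M hMb ⟨?_, ?_⟩)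
  · rwa [isTauRigid_iff_isRigid]
  · rw [hMn, he.numSummands k]

/-- The quotient A/I has finite length, hence projective dimension at most one, and `I` is its first
syzygy with respect to `A`. -/
theorem projective_of_forall_isSimpleModule (k : Type u) {A : Type v} [Field k] [Ring A]
    [Algebra k A] [FiniteDimensional k A]
    (h : ∀ (S : Type v) [AddCommGroup S] [Module Aᵐᵒᵖ S] [IsSimpleModule Aᵐᵒᵖ S],
      CategoryTheory.HasProjectiveDimensionLE (ModuleCat.of Aᵐᵒᵖ S) 1) (I : Submodule Aᵐᵒᵖ A) :
    Module.Projective Aᵐᵒᵖ I := by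
  have : IsArtinianRing Aᵐᵒᵖ := isArtinian_of_tower k inferInstance
  exact projective_of_hasProjectiveDimensionLE (LinearMap.exact_subtype_mkQ I)
    I.injective_subtype I.mkQ_surjective (hasProjectiveDimensionLE_of_isFiniteLength 1 h
      (isFiniteLength_iff_isNoetherian_isArtinian.2 ⟨inferInstance, inferInstance⟩))

end TauTiltingTheorem

end TauTilting

theorem theorem2p1 {k : Type u} {A : Type v} [Field k] [IsAlgClosed k] [Ring A] [Algebra k A]
    [FiniteDimensional k A] (hA : TauTilting.IsBasicAlgebra A) :
    TauTilting.IsHereditary A ↔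
      (∀ x : TauTilting.OrdinaryQuiver k hA, IsEmpty (x ⟶ x)) ∧
      ∀ (M : Type v) [AddCommGroup M] [Module Aᵐᵒᵖ M] [Module.Finite Aᵐᵒᵖ M],
        TauTilting.IsBasicModule Aᵐᵒᵖ M → TauTilting.IsTauTilting k A M →
          TauTilting.IsTilting A M := by
  have : IsArtinianRing Aᵐᵒᵖ := isArtinian_of_tower k inferInstance
  have he := hA.choose_spec.choose_spec
  constructor
  · refine fun h => ⟨fun x => (TauTilting.isEmpty_hom_iff k hA x x).2 fun z hz => ?_,
      fun M _ _ _ _ hM => hM.isTilting k he h.1⟩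
    exact TauTilting.mul_mul_eq_zero_of_projective k h.1 (he.2.1 x) hz ▸ zero_mem _
  · rintro ⟨hloop, h⟩
    have hr : ∀ I : Submodule Aᵐᵒᵖ A, Module.Projective Aᵐᵒᵖ I :=
      TauTilting.projective_of_forall_isSimpleModule k
        fun S _ _ _ => TauTilting.hasProjectiveDimensionLE_of_isSimpleModule k he
          (fun i => (TauTilting.isEmpty_hom_iff k hA i i).1 (hloop i))
          (fun M _ _ _ hMb hM => (h M hMb hM).1) S
    exact ⟨hr, TauTilting.projective_of_forall_projective_op k hr⟩
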